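/- **The Fuller problem.** An admissible trajectory on a time interval $I=[0,\infty)$ or $I=[0,t_1]$ consists of functions $x,y$ and a measurable control $u$ on $I$ with $|u|\le 1$ a.e., $\dot x=y$ and $\dot y=u$ (in the Carathéodory sense). For $(a,b)\in\mathbb R^2$ let $J_F(a,b)$ be the infimum of $\frac12\int_0^\infty x^2\,dt$ over all admissible trajectories on $[0,\infty)$ with $x(0)=a$, $y(0)=b$, and let $T_F(a,b)$ be the smallest $T\ge 0$ such that the optimal trajectory from $(a,b)$ satisfies $x(t)=y(t)=0$ for all $t\ge T$. (It is classical that the optimal trajectory exists and is unique, and that $T_F(a,b)<\infty$.) **The Finsler structure.** On $\mathbb R^4=\{q=(x,y,z,w)\}$ consider the family of norms $$\|\xi\|_q=\max(|\xi_2|,|\xi_4|)+|\xi_1-y\,\xi_4|+|\xi_3-\tfrac12x^2\xi_4|,\qquad \xi=(\xi_1,\xi_2,\xi_3,\xi_4)\in T_q\mathbb R^4 .$$ The length of an absolutely continuous curve $q:[a,b]\to\mathbb R^4$ is $\int_a^b\|\dot q(t)\|_{q(t)}\,dt$, and a shortest path between two points is an absolutely continuous curve of minimal length among all those connecting them. **Theorem.**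 Put $f_1(q)=(y,0,\frac12x^2,1)$, $f_2=(0,1,0,0)$, $f_3=(-1,0,0,0)$, $f_6=(0,0,1,0)$. For every $q$ the vectors $f_1(q)+f_2$, $f_1(q)-f_2$, $f_3$, $f_6$ are linearly independent, and the unit ball $\{\xi:\|\xi\|_q\le1\}$ is the hyperoctahedron with the 8 vertices $\pm(f_1(q)+f_2)$, $\pm(f_1(q)-f_2)$, $\pm f_3$, $\pm f_6$. Let $q_0=(x_0,y_0,z_0,w_0)$ and $q_1=(x_1,y_1,z_1,w_1)$ be points of $\mathbb R^4$ with $$z_1-z_0=J_F(x_0,y_0)+J_F(x_1,-y_1),\qquad t_1:=w_1-w_0\ \ge\ T_F(x_0,y_0)+T_F(x_1,-y_1).$$ Then the problem of minimizing $\frac12\int_0^{t_1}x^2\,dt$ over the admissible trajectories on $[0,t_1]$ with $(x,y)(0)=(x_0,y_0)$ and $(x,y)(t_1)=(x_1,y_1)$ has an optimal trajectory. Let $(x_F,y_F)$, with control $u_F$, be any such optimal trajectory, and put $$q_F(t)=\Bigl(x_F(t),\;y_F(t),\;z_0+\tfrac12\int_0^t x_F(s)^2\,ds,\;w_0+t\Bigr),\qquad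 t\in[0,t_1].$$ 1. $q_F$ is a shortest path from $q_0$ to $q_1$ and has length $t_1$; moreover $\dot q_F=f_1(q_F)+u_F f_2$ and $\|\dot q_F\|_{q_F}=1$ almost everywhere on $[0,t_1]$. 2. $q_F$ is the unique shortest path: every shortest path $q:[a,b]\to\mathbb R^4$ from $q_0$ to $q_1$ has the form $q=q_F\circ\varphi$ with $\varphi:[a,b]\to[0,t_1]$ continuous, nondecreasing, $\varphi(a)=0$, $\varphi(b)=t_1$. Moreover, for every absolutely continuous curve $q:[0,T]\to\mathbb R^4$ from $q_0$ to $q_1$ with $\|\dot q\|_q\le 1$ a.e. one has $T\ge t_1$, and if $T=t_1$ then $q=q_F$ on $[0,t_1]$. 3. $q_F$ chatters. If $(x_0,y_0)\ne(0,0)$, then there are times $0=s_0<s_1<s_2<\cdots\to T_F(x_0,y_0)$ such that $u_F$ is a.e. equal to a constant $\pm1$ on each $(s_k,s_{k+1})$, with opposite signs on consecutive intervals. If $(x_1,y_1)\ne(0,0)$, then there are times $t_1=s_0>s_1>s_2>\cdots\to t_1-T_F(x_1,-y_1)$ such that $u_F$ is a.e. equal to a constant $\pm1$ on each $(s_{k+1},s_k)$,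 with opposite signs on consecutive intervals. Between the times $T_F(x_0,y_0)$ and $t_1-T_F(x_1,-y_1)$ one has $x_F=y_F=0$, and $u_F=0$ almost everywhere. -/

import Mathlib

open MeasureTheory Set Filter Topology
open scoped ENNReal

noncomputable section

namespace FullerFinsler

/-! ### The Fuller problem -/

/-- `(x, y)` with control `u` is an admissible trajectory of `x' = y`, `y' = u`, `|u| ≤ 1`
starting from `(x₀, y₀)` at time `0`, on the time interval `I` (which is `[0, ∞)` or `[0, T]`).
The differential equations are understood in the Carathéodory sense (integral form). -/
structure IsTrajectory (I : Set ℝ) (x₀ y₀ : ℝ) (x y u : ℝ → ℝ) : Prop where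
  aemeasurable : AEMeasurable u (volume.restrict I)
  abs_le_one : ∀ᵐ t ∂(volume.restrict I), |u t| ≤ 1
  y_eq : ∀ t ∈ I, y t = y₀ + ∫ s in (0 : ℝ)..t, u s
  x_eq : ∀ t ∈ I, x t = x₀ + ∫ s in (0 : ℝ)..t, y s

/-- The Fuller functional `½ ∫₀^∞ x² dt`, with values in `[0, ∞]`. -/
def cost (x : ℝ → ℝ) : ℝ≥0∞ := ∫⁻ t in Ici (0 : ℝ), ENNReal.ofReal (x t ^ 2 / 2)

/-- Optimal trajectories of the Fuller problem on `[0, ∞)` with initial point `(x₀, y₀)`. -/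
def IsOptimal (x₀ y₀ : ℝ) (x y u : ℝ → ℝ) : Prop :=
  IsTrajectory (Ici 0) x₀ y₀ x y u ∧
    ∀ x' y' u' : ℝ → ℝ, IsTrajectory (Ici 0) x₀ y₀ x' y' u' → cost x ≤ cost x'

/-- The optimal value `J_F(x₀, y₀)` of the Fuller problem. -/
def JF (x₀ y₀ : ℝ) : ℝ :=
  (sInf {c : ℝ≥0∞ | ∃ x y u : ℝ → ℝ, IsTrajectory (Ici 0) x₀ y₀ x y u ∧ c = cost x}).toReal

/-- The time `T_F(x₀, y₀)` at which the optimal trajectory of the Fuller problem comes to rest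
at the origin. -/
def TF (x₀ y₀ : ℝ) : ℝ :=
  sInf {T : ℝ | 0 ≤ T ∧ ∃ x y u : ℝ → ℝ, IsOptimal x₀ y₀ x y u ∧
    ∀ t, T ≤ t → x t = 0 ∧ y t = 0}

/-- Admissible trajectories on `[0, t₁]` from `(x₀, y₀)` to `(x₁, y₁)`. -/
def IsFiniteTrajectory (t₁ x₀ y₀ x₁ y₁ : ℝ) (x y u : ℝ → ℝ) : Prop :=
  IsTrajectory (Icc 0 t₁) x₀ y₀ x y u ∧ x t₁ = x₁ ∧ y t₁ = y₁

/-- Optimal trajectories of the Fuller problem `½ ∫₀^{t₁} x² dt → min` on `[0, t₁]` with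
both endpoints fixed. -/
def IsFiniteOptimal (t₁ x₀ y₀ x₁ y₁ : ℝ) (x y u : ℝ → ℝ) : Prop :=
  IsFiniteTrajectory t₁ x₀ y₀ x₁ y₁ x y u ∧
    ∀ x' y' u' : ℝ → ℝ, IsFiniteTrajectory t₁ x₀ y₀ x₁ y₁ x' y' u' →
      (1 / 2) * ∫ t in (0 : ℝ)..t₁, x t ^ 2 ≤ (1 / 2) * ∫ t in (0 : ℝ)..t₁, x' t ^ 2

/-- The control `u` on `[0, T]` takes only the values `1` and `-1` and switches between them
at countably many times, which accumulate at `T` from the left: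
the switching times are `s 1 < s 2 < ⋯ → T`. -/
def ChattersBefore (u : ℝ → ℝ) (T : ℝ) : Prop :=
  ∃ (s : ℕ → ℝ) (σ : ℝ), s 0 = 0 ∧ StrictMono s ∧ Tendsto s atTop (𝓝 T) ∧ (σ = 1 ∨ σ = -1) ∧
    ∀ k : ℕ, ∀ᵐ t ∂(volume.restrict (Ioo (s k) (s (k + 1)))), u t = (-1) ^ k * σ

/-- The control `u` on `[T, t₁]` takes only the values `1` and `-1` and switches between them
at countably many times, which accumulate at `T` from the right:
the switching times are `s 1 > s 2 > ⋯ → T`. -/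
def ChattersAfter (u : ℝ → ℝ) (T t₁ : ℝ) : Prop :=
  ∃ (s : ℕ → ℝ) (σ : ℝ), s 0 = t₁ ∧ StrictAnti s ∧ Tendsto s atTop (𝓝 T) ∧ (σ = 1 ∨ σ = -1) ∧
    ∀ k : ℕ, ∀ᵐ t ∂(volume.restrict (Ioo (s (k + 1)) (s k))), u t = (-1) ^ k * σ

/-! ### The Finsler structure on `ℝ⁴ = {q = (x, y, z, w)}` -/

/-- The vector field `(y, 0, x²/2, 1)`. -/
def f1 (q : Fin 4 → ℝ) : Fin 4 → ℝ := ![q 1, 0, (q 0) ^ 2 / 2, 1]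

/-- The vector field `(0, 1, 0, 0)`. -/
def f2 (_q : Fin 4 → ℝ) : Fin 4 → ℝ := ![0, 1, 0, 0]

/-- The vector field `(-1, 0, 0, 0)`. -/
def f3 (_q : Fin 4 → ℝ) : Fin 4 → ℝ := ![-1, 0, 0, 0]

/-- The vector field `(0, 0, 1, 0)`. -/
def f6 (_q : Fin 4 → ℝ) : Fin 4 → ℝ := ![0, 0, 1, 0]

/-- Four pairwise non-opposite vertices of the unit ball at `q`; the other four vertices are
their opposites. -/
def vertex (q : Fin 4 → ℝ) : Fin 4 → (Fin 4 → ℝ) := ![f1 q + f2 q, f1 q - f2 q, f3 q, f6 q]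

/-- The Finsler norm `max(|ξ₂|, |ξ₄|) + |ξ₁ - y ξ₄| + |ξ₃ - ½ x² ξ₄|` of the tangent vector
`ξ = (ξ₁, ξ₂, ξ₃, ξ₄)` at the point `q = (x, y, z, w)`. -/
def finslerNorm (q ξ : Fin 4 → ℝ) : ℝ :=
  max |ξ 1| |ξ 3| + |ξ 0 - q 1 * ξ 3| + |ξ 2 - (q 0) ^ 2 / 2 * ξ 3|

/-- `q`, restricted to `[a, b]`, is an absolutely continuous curve from `p` to `p'`. -/
def IsCurve (p p' : Fin 4 → ℝ) (a b : ℝ) (q : ℝ → Fin 4 → ℝ) : Prop :=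
  a ≤ b ∧ AbsolutelyContinuousOnInterval q a b ∧ q a = p ∧ q b = p'

/-- The Finsler length of the restriction of `q` to `[a, b]`. -/
def finslerLength (a b : ℝ) (q : ℝ → Fin 4 → ℝ) : ℝ :=
  ∫ t in a..b, finslerNorm (q t) (deriv q t)

/-- `q`, restricted to `[a, b]`, is a shortest path from `p` to `p'`. -/
def IsShortestPath (p p' : Fin 4 → ℝ) (a b : ℝ) (q : ℝ → Fin 4 → ℝ) : Prop :=
  IsCurve p p' a b q ∧
    ∀ (a' b' : ℝ) (q' : ℝ → Fin 4 → ℝ), IsCurve p p' a' b' q' →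
      finslerLength a b q ≤ finslerLength a' b' q'

/-- The curve `(x(t), y(t), z₀ + ½ ∫₀ᵗ x(s)² ds, w₀ + t)`. -/
def lift (z₀ w₀ : ℝ) (x y : ℝ → ℝ) (t : ℝ) : Fin 4 → ℝ :=
  ![x t, y t, z₀ + (1 / 2) * ∫ s in (0 : ℝ)..t, x s ^ 2, w₀ + t]

end FullerFinsler

end

namespace FullerFinsler

/-! ### The self-similar chattering arc, in reversed time -/

/-! The coordinate `w` calibrates the Finsler norm: `ξ 3 ≤ finslerNorm q ξ` (`le_finslerNorm`), so
every curve has length at least the increment of `w`. Equality forces `|ẏ| ≤ ẇ`, `ẋ = y ẇ` and `ż =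
½ x² ẇ` almost everywhere, so the curve, reparametrized by `w`, is the lift of an admissible
trajectory on `[0, w₁ - w₀]` with cost exactly `z₁ - z₀` (`IsCurve.exists_trajectory`). By the
choice of `z₁ - z₀` this cost is the minimum of the two-endpoint Fuller problem, whose minimizer is
unique; hence so is the shortest path.

That minimizer is the Fuller arc from `(x₀, y₀)` to the origin, then rest, then the time reversal of
the Fuller arc from `(x₁, -y₁)`; the bound on `w₁ - w₀` makes the arcs fit. Optimality and
uniqueness come from a sufficient maximum principle (`integral_sq_add_integral_sq_sub_le`): since
the problem is convex, adjoint functions with `p' = x`, `q' = -p`, `q u = |q|` bound the excess cost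
below by a multiple of `∫ (x' - x)²`.

It remains to exhibit Fuller arcs with their adjoints (`exists_isExtremal`). In reversed time all of
them come from one self-similar arc, with control alternating on the intervals `(m ^ (k + 1), m ^
k]`. Its four iterated integrals give `y`, `x`, `p`, `q` up to sign and scale. The quartic equation
for `m` makes the fourth integral vanish at the switching points, so that `q` changes sign with `u`.
Scaling and reflection carry the arc through every nonzero point of the plane (`exists_chatter_eq`).
Since the extremal is the unique optimum, `JF` and `TF` are read off from it. -/

lemma exists_ratio :
    ∃ m : ℝ, 0.24 < m ∧ m < 0.245 ∧ m ^ 4 - 3 * m ^ 3 - 4 * m ^ 2 - 3 * m + 1 = 0 := by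
  have hc : ContinuousOn (fun m : ℝ => m ^ 4 - 3 * m ^ 3 - 4 * m ^ 2 - 3 * m + 1)
      (Icc 0.24 0.245) := by fun_prop
  have h := intermediate_value_Icc' (by norm_num) hc
  obtain ⟨m, hm, h0⟩ := h (show (0 : ℝ) ∈ Icc _ _ by constructor <;> norm_num)
  dsimp only at h0
  refine ⟨m, lt_of_le_of_ne hm.1 ?_, lt_of_le_of_ne hm.2 ?_, h0⟩
  · rintro rfl; norm_num at h0
  · rintro rfl; norm_num at h0

/-- The sign function alternating on the intervals `(m ^ (k + 1), m ^ k]`, extended by `0`. -/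
noncomputable def chatterU (m r : ℝ) : ℝ :=
  if 0 < r then (-1 : ℝ) ^ ⌊Real.log r / Real.log m⌋ else 0

/-- The primitive vanishing at `0`. -/
noncomputable def prim (f : ℝ → ℝ) (r : ℝ) : ℝ := ∫ s in (0 : ℝ)..r, f s

lemma measurable_chatterU (m : ℝ) : Measurable (chatterU m) := by
  unfold chatterU
  refine Measurable.ite (measurableSet_lt measurable_const measurable_id) ?_ measurable_const
  have h : Measurable fun r : ℝ => ⌊Real.log r / Real.log m⌋ :=
    Int.measurable_floor.comp (Real.measurable_log.div_const _)
  exact (measurable_from_top (f := fun n : ℤ => (-1 : ℝ) ^ n)).comp h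

lemma abs_chatterU_of_pos (m : ℝ) {r : ℝ} (hr : 0 < r) : |chatterU m r| = 1 := by
  simp [chatterU, hr, abs_zpow]

lemma chatterU_of_nonpos (m : ℝ) {r : ℝ} (hr : r ≤ 0) : chatterU m r = 0 := by
  simp [chatterU, not_lt.2 hr]

lemma abs_chatterU_le (m r : ℝ) : |chatterU m r| ≤ 1 := by
  rcases lt_or_ge 0 r with hr | hr
  · exact (abs_chatterU_of_pos m hr).le
  · simp [chatterU_of_nonpos m hr]

/-- Multiplying `r` by `m` raises the floor by one. The factor `-m ^ 0` is the case `n = 0` of the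
hypothesis of `prim_mul`. -/
lemma chatterU_mul {m : ℝ} (hm : 0 < m) (hm1 : m < 1) (r : ℝ) :
    chatterU m (m * r) = -m ^ 0 * chatterU m r := by
  rcases lt_or_ge 0 r with hr | hr
  · have hl : Real.log m ≠ 0 := (Real.log_neg hm hm1).ne
    have : Real.log (m * r) / Real.log m = 1 + Real.log r / Real.log m := by
      rw [Real.log_mul hm.ne' hr.ne']; field_simp
    simp only [chatterU, mul_pos hm hr, hr, if_true, this]
    rw [add_comm (1 : ℝ), Int.floor_add_one, zpow_add_one₀ (by norm_num)]; simp
  · simp [chatterU_of_nonpos m hr, chatterU_of_nonpos m (mul_nonpos_of_nonneg_of_nonpos hm.le hr)]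

lemma chatterU_eq {m : ℝ} (hm : 0 < m) (hm1 : m < 1) {r : ℝ} {k : ℕ} (h1 : m ^ (k + 1) < r)
    (h2 : r ≤ m ^ k) : chatterU m r = (-1) ^ k := by
  have hr : 0 < r := (pow_pos hm _).trans h1
  have hl : Real.log m < 0 := Real.log_neg hm hm1
  have : ⌊Real.log r / Real.log m⌋ = (k : ℤ) := by
    rw [Int.floor_eq_iff]
    constructor
    · rw [le_div_iff_of_neg hl]
      simpa using Real.log_le_log hr h2
    · rw [div_lt_iff_of_neg hl]
      simpa using Real.log_lt_log (pow_pos hm _) h1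
  simp [chatterU, hr, this]

lemma intervalIntegrable_chatterU (m a b : ℝ) : IntervalIntegrable (chatterU m) volume a b :=
  (intervalIntegrable_const (c := (1 : ℝ))).mono_fun (measurable_chatterU m).aestronglyMeasurable
    (Eventually.of_forall fun r => by simpa using abs_chatterU_le m r)

/-- The substitution `s ↦ m s` contributes one factor `m`. The conclusion has the shape of the
hypothesis, so the lemma iterates. -/
lemma prim_mul {f : ℝ → ℝ} {m : ℝ} {n : ℕ} (h : ∀ r, f (m * r) = -m ^ n * f r) (r : ℝ) :
    prim f (m * r) = -m ^ (n + 1) * prim f r := by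
  have := intervalIntegral.mul_integral_comp_mul_left (f := f) (a := 0) (b := r) m
  rw [mul_zero] at this
  simp only [prim]
  rw [← this]
  simp only [h, intervalIntegral.integral_const_mul]
  ring

lemma prim_of_nonpos {f : ℝ → ℝ} (h : ∀ r ≤ 0, f r = 0) : ∀ r ≤ 0, prim f r = 0 := by
  intro r hr
  rw [prim, intervalIntegral.integral_congr (g := fun _ => 0)]
  · simp
  · intro s hs
    rw [uIcc_of_ge hr] at hs
    exact h s hs.2

lemma hasDerivAt_prim {f : ℝ → ℝ} (h : Continuous f) (r : ℝ) : HasDerivAt (prim f) (f r) r :=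
  intervalIntegral.integral_hasDerivAt_right (h.intervalIntegrable _ _)
    (h.stronglyMeasurableAtFilter _ _) h.continuousAt

lemma continuous_prim {f : ℝ → ℝ} (h : Continuous f) : Continuous (prim f) :=
  continuous_iff_continuousAt.2 fun r => (hasDerivAt_prim h r).continuousAt

lemma prim_eq_of_hasDerivAt {f F F' : ℝ → ℝ} {m r : ℝ}
    (hf : ∀ a b, IntervalIntegrable f volume a b) (hF : ∀ s, HasDerivAt F (F' s) s)
    (hF' : Continuous F') (h : ∀ s ∈ Ioc m 1, f s = F' s) (hr : r ∈ Icc m 1) :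
    prim f r = prim f 1 - (F 1 - F r) := by
  rw [← intervalIntegral.integral_eq_sub_of_hasDerivAt (fun s _ => hF s)
    (hF'.intervalIntegrable r 1)]
  have h1 : ∫ s in r..1, F' s = ∫ s in r..1, f s := by
    refine intervalIntegral.integral_congr_ae (Eventually.of_forall fun s hs => ?_)
    rw [uIoc_of_le hr.2] at hs
    exact (h s ⟨hr.1.trans_lt hs.1, hs.2⟩).symm
  rw [h1, prim, prim, ← intervalIntegral.integral_interval_sub_left (hf 0 1) (hf 0 r)]
  ring

/-- The first integral of `chatterU`. -/
noncomputable def chatterY (m : ℝ) : ℝ → ℝ := prim (chatterU m)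
/-- The second integral of `chatterU`. -/
noncomputable def chatterX (m : ℝ) : ℝ → ℝ := prim (chatterY m)
/-- The third integral of `chatterU`. -/
noncomputable def chatterZ (m : ℝ) : ℝ → ℝ := prim (chatterX m)
/-- The fourth integral of `chatterU`. -/
noncomputable def chatterW (m : ℝ) : ℝ → ℝ := prim (chatterZ m)

lemma continuous_chatterY (m : ℝ) : Continuous (chatterY m) :=
  intervalIntegral.continuous_primitive (fun a b => intervalIntegrable_chatterU m a b) 0
lemma continuous_chatterX (m : ℝ) : Continuous (chatterX m) :=
  continuous_prim (continuous_chatterY m)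
lemma continuous_chatterZ (m : ℝ) : Continuous (chatterZ m) :=
  continuous_prim (continuous_chatterX m)

lemma chatter_of_nonpos (m : ℝ) {r : ℝ} (hr : r ≤ 0) :
    chatterY m r = 0 ∧ chatterX m r = 0 ∧ chatterZ m r = 0 ∧ chatterW m r = 0 := by
  have hU : ∀ r ≤ 0, chatterU m r = 0 := fun r hr => chatterU_of_nonpos m hr
  have hY := prim_of_nonpos hU
  have hX := prim_of_nonpos hY
  have hZ := prim_of_nonpos hX
  exact ⟨hY r hr, hX r hr, hZ r hr, prim_of_nonpos hZ r hr⟩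

lemma chatter_mul {m : ℝ} (hm : 0 < m) (hm1 : m < 1) (r : ℝ) :
    chatterY m (m * r) = -m ^ 1 * chatterY m r ∧ chatterX m (m * r) = -m ^ 2 * chatterX m r ∧
    chatterZ m (m * r) = -m ^ 3 * chatterZ m r ∧ chatterW m (m * r) = -m ^ 4 * chatterW m r := by
  have hY := prim_mul (chatterU_mul hm hm1)
  have hX := prim_mul hY
  have hZ := prim_mul hX
  exact ⟨hY r, hX r, hZ r, prim_mul hZ r⟩

lemma chatter_eq_of_mem {m : ℝ} (hm : 0 < m) (hm1 : m < 1) :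
    (∀ r ∈ Icc m 1, chatterY m r = chatterY m 1 - (1 - r)) ∧
    (∀ r ∈ Icc m 1, chatterX m r = chatterX m 1 - chatterY m 1 * (1 - r) + (1 - r) ^ 2 / 2) ∧
    (∀ r ∈ Icc m 1, chatterZ m r = chatterZ m 1 - chatterX m 1 * (1 - r)
      + chatterY m 1 * (1 - r) ^ 2 / 2 - (1 - r) ^ 3 / 6) ∧
    (∀ r ∈ Icc m 1, chatterW m r = chatterW m 1 - chatterZ m 1 * (1 - r)
      + chatterX m 1 * (1 - r) ^ 2 / 2 - chatterY m 1 * (1 - r) ^ 3 / 6 + (1 - r) ^ 4 / 24) := by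
  have h (s : ℝ) : HasDerivAt (fun r : ℝ => 1 - r) (-1) s := (hasDerivAt_id s).const_sub 1
  have hY : ∀ r ∈ Icc m 1, chatterY m r = chatterY m 1 - (1 - r) := fun r hr =>
    prim_eq_of_hasDerivAt (m := m) (intervalIntegrable_chatterU m) (F := fun r => r)
      (F' := fun _ => 1) (fun s => hasDerivAt_id s) continuous_const
      (fun s hs => (chatterU_eq hm hm1 (k := 0) (by simpa using hs.1)
        (by simpa using hs.2)).trans (pow_zero _)) hr
  have hX : ∀ r ∈ Icc m 1, chatterX m r
      = chatterX m 1 - chatterY m 1 * (1 - r) + (1 - r) ^ 2 / 2 := fun r hr => by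
    rw [chatterX, prim_eq_of_hasDerivAt (fun a b => (continuous_chatterY m).intervalIntegrable a b)
      (F := fun r => -(chatterY m 1 * (1 - r)) + (1 - r) ^ 2 / 2)
      (F' := fun r => chatterY m 1 - (1 - r)) (fun s => ?_) (by fun_prop)
      (fun s hs => hY s (Ioc_subset_Icc_self hs)) hr]
    · ring
    · convert! (((h s).const_mul (chatterY m 1)).neg).add (((h s).pow 2).div_const 2) using 1
      ring
  have hZ : ∀ r ∈ Icc m 1, chatterZ m r = chatterZ m 1 - chatterX m 1 * (1 - r)
      + chatterY m 1 * (1 - r) ^ 2 / 2 - (1 - r) ^ 3 / 6 := fun r hr => by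
    rw [chatterZ, prim_eq_of_hasDerivAt (fun a b => (continuous_chatterX m).intervalIntegrable a b)
      (F := fun r => -(chatterX m 1 * (1 - r)) + chatterY m 1 * ((1 - r) ^ 2 / 2)
        - (1 - r) ^ 3 / 6) (fun s => ?_) (by fun_prop)
      (fun s hs => hX s (Ioc_subset_Icc_self hs)) hr]
    · ring
    · convert! ((((h s).const_mul (chatterX m 1)).neg).add
        ((((h s).pow 2).div_const 2).const_mul (chatterY m 1))).sub (((h s).pow 3).div_const 6)
        using 1
      ring
  refine ⟨hY, hX, hZ, fun r hr => ?_⟩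
  rw [chatterW, prim_eq_of_hasDerivAt (fun a b => (continuous_chatterZ m).intervalIntegrable a b)
    (F := fun r => -(chatterZ m 1 * (1 - r)) + chatterX m 1 * ((1 - r) ^ 2 / 2)
      - chatterY m 1 * ((1 - r) ^ 3 / 6) + (1 - r) ^ 4 / 24) (fun s => ?_) (by fun_prop)
    (fun s hs => hZ s (Ioc_subset_Icc_self hs)) hr]
  · ring
  · convert! (((((h s).const_mul (chatterZ m 1)).neg).add
      ((((h s).pow 2).div_const 2).const_mul (chatterX m 1))).sub
      ((((h s).pow 3).div_const 6).const_mul (chatterY m 1))).add (((h s).pow 4).div_const 24)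
      using 1
    ring

/-- The values at `1`, determined by self-similarity. -/
lemma chatter_one {m : ℝ} (hm : 0 < m) (hm1 : m < 1) :
    chatterY m 1 * (1 + m) = 1 - m ∧
    chatterX m 1 * (1 + m ^ 2) = chatterY m 1 * (1 - m) - (1 - m) ^ 2 / 2 ∧
    chatterZ m 1 * (1 + m ^ 3) = chatterX m 1 * (1 - m) - chatterY m 1 * (1 - m) ^ 2 / 2
      + (1 - m) ^ 3 / 6 ∧
    chatterW m 1 * (1 + m ^ 4) = chatterZ m 1 * (1 - m) - chatterX m 1 * (1 - m) ^ 2 / 2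
      + chatterY m 1 * (1 - m) ^ 3 / 6 - (1 - m) ^ 4 / 24 := by
  obtain ⟨h1, h2, h3, h4⟩ := chatter_eq_of_mem hm hm1
  obtain ⟨g1, g2, g3, g4⟩ := chatter_mul hm hm1 1
  rw [mul_one] at g1 g2 g3 g4
  have hmem : m ∈ Icc m 1 := ⟨le_rfl, hm1.le⟩
  have e1 := h1 m hmem
  have e2 := h2 m hmem
  have e3 := h3 m hmem
  have e4 := h4 m hmem
  refine ⟨?_, ?_, ?_, ?_⟩ <;> linarith

/-- This is the maximum condition `q u ≥ 0` in reversed time, where `q` corresponds to `-chatterW`.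
By self-similarity it reduces to the sign of the quartic `chatterW` on `[m, 1]`, both of whose
endpoints are zeros. -/
lemma chatterW_mul_chatterU_nonpos {m : ℝ} (hm : 0.24 < m) (hm1 : m < 0.245)
    (hp : m ^ 4 - 3 * m ^ 3 - 4 * m ^ 2 - 3 * m + 1 = 0) {r : ℝ} (hr : r ∈ Ioc 0 1) :
    chatterW m r * chatterU m r ≤ 0 := by
  have hm0 : 0 < m := by linarith
  have hmlt : m < 1 := by linarith
  obtain ⟨-, -, -, h4⟩ := chatter_eq_of_mem hm0 hmlt
  obtain ⟨a1, a2, a3, a4⟩ := chatter_one hm0 hmlt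
  generalize chatterY m 1 = Y at *
  generalize chatterX m 1 = X at *
  generalize chatterZ m 1 = Z at *
  have hY : Y = (1 - m) / (1 + m) := by rw [eq_div_iff (by positivity)]; exact a1
  have hX : X = (1 - m) ^ 3 / (2 * ((1 + m) * (1 + m ^ 2))) := by
    rw [eq_div_iff (by positivity)]
    linear_combination 2 * (1 + m) * a2 + 2 * (1 - m) * a1
  -- The right side is the value of `Z` for which `chatterW m 1 = 0`; it agrees with the value
  -- forced by self-similarity exactly because `m` solves the quartic.
  have hZ : Z = (1 - m) * (X / 2 - Y * (1 - m) / 6 + (1 - m) ^ 2 / 24) := by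
    have : Z = (X * (1 - m) - Y * (1 - m) ^ 2 / 2 + (1 - m) ^ 3 / 6) / (1 + m ^ 3) := by
      rw [eq_div_iff (by positivity)]; exact a3
    rw [this, div_eq_iff (by positivity), ← sub_eq_zero, hX, hY]
    calc _ = (1 - m) ^ 3 * (1 - m ^ 2) * (m ^ 4 - 3 * m ^ 3 - 4 * m ^ 2 - 3 * m + 1)
          / (24 * ((1 + m) * (1 + m ^ 2))) := by field_simp; ring
      _ = 0 := by rw [hp]; simp
  have hW : chatterW m 1 = 0 := by
    have : chatterW m 1 * (1 + m ^ 4) = 0 := by rw [a4, hZ]; ring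
    rcases mul_eq_zero.1 this with h | h
    · exact h
    · nlinarith [pow_pos hm0 4]
  have base : ∀ r ∈ Icc m 1, chatterW m r ≤ 0 := by
    intro r hr
    rw [h4 r hr, hW, hZ]
    have hs0 : 0 ≤ 1 - r := by linarith [hr.2]
    have hsh : 1 - r ≤ 1 - m := by linarith [hr.1]
    generalize 1 - r = s at *
    -- With `h = 1 - m`, the quartic is `-s (h - s)` times this quadratic. The quadratic is
    -- nonnegative at `s = h` (`h1`), and its value at `s` exceeds that by `(h - s) (4 Y - 2 h - s)
    -- / 24`, which is nonnegative by `h2`.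
    have key : 0 ≤ s ^ 2 / 24 + ((1 - m) / 24 - Y / 6) * s
        + (X / 2 - Y * (1 - m) / 6 + (1 - m) ^ 2 / 24) := by
      have h1 : 0 ≤ X / 2 - Y * (1 - m) / 3 + (1 - m) ^ 2 / 8 := by
        have : X / 2 - Y * (1 - m) / 3 + (1 - m) ^ 2 / 8 = (1 - m) ^ 2
            * (1 - 3 * m - 5 * m ^ 2 + 3 * m ^ 3) / (24 * ((1 + m) * (1 + m ^ 2))) := by
          rw [hX, hY]; field_simp; ring
        rw [this]
        -- This cubic changes sign near `0.247`, which explains the tight upper bound `0.245` on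
        -- `m`.
        have : 0 ≤ 1 - 3 * m - 5 * m ^ 2 + 3 * m ^ 3 := by nlinarith [pow_pos hm0 3]
        positivity
      have h2 : 3 * (1 - m) ≤ 4 * Y := by
        rw [hY, ← mul_div_assoc, le_div_iff₀ (by positivity)]
        nlinarith
      nlinarith [mul_nonneg (sub_nonneg.2 hsh) (show 0 ≤ 4 * Y - (1 - m) - (1 - m) - s by linarith)]
    have := mul_nonneg (mul_nonneg hs0 (sub_nonneg.2 hsh)) key
    nlinarith [this]
  -- Rescaling by `m ^ k` moves `r` into `[m, 1]`; the signs `(-1) ^ k` of `chatterW` and `chatterU`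
  -- cancel.
  obtain ⟨k, hk1, hk2⟩ := exists_nat_pow_near_of_lt_one hr.1 hr.2 hm0 hmlt
  rw [chatterU_eq hm0 hmlt hk1 hk2]
  have hmul : ∀ (k : ℕ) (r : ℝ), chatterW m (m ^ k * r) = (-1) ^ k * m ^ (4 * k) * chatterW m r := by
    intro k
    induction k with
    | zero => simp
    | succ k ih =>
      intro r
      rw [pow_succ', mul_assoc, (chatter_mul hm0 hmlt _).2.2.2, ih]
      ring
  have hmk : 0 < m ^ k := pow_pos hm0 k
  have hr' : r = m ^ k * (r / m ^ k) := by field_simp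
  rw [hr', hmul]
  have hb := base (r / m ^ k) ⟨by rw [le_div_iff₀ hmk, ← pow_succ']; exact hk1.le,
    by rw [div_le_one hmk]; exact hk2⟩
  have : ((-1 : ℝ) ^ k) * (-1) ^ k = 1 := by rw [← mul_pow]; simp
  calc _ = ((-1 : ℝ) ^ k * (-1) ^ k) * (m ^ (4 * k) * chatterW m (r / m ^ k)) := by ring
    _ ≤ 0 := by
      rw [this, one_mul]
      exact mul_nonpos_of_nonneg_of_nonpos (by positivity) hb

/-- Up to the symmetries of the Fuller problem, every point of the closed lower half plane other
than the origin lies on the chattering arc. -/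
lemma exists_chatter_eq_of_nonpos {m : ℝ} (hm : 0 < m) (hm1 : m < 1) {a b : ℝ} (hb : b ≤ 0)
    (hab : b = 0 → a ≠ 0) :
    ∃ σ l r : ℝ, (σ = 1 ∨ σ = -1) ∧ 0 < l ∧ r ∈ Ioc m 1 ∧
      a = σ * l ^ 2 * chatterX m r ∧ b = -σ * l * chatterY m r := by
  obtain ⟨h1, h2, -, -⟩ := chatter_eq_of_mem hm hm1
  obtain ⟨a1, a2, -, -⟩ := chatter_one hm hm1
  set Y := chatterY m 1 with hYdef
  set X := chatterX m 1 with hXdef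
  have hY : Y = (1 - m) / (1 + m) := by rw [eq_div_iff (by positivity)]; exact a1
  have hY0 : 0 < Y := by rw [hY]; exact div_pos (by linarith) (by linarith)
  have hX : X = (1 - m) ^ 3 / (2 * ((1 + m) * (1 + m ^ 2))) := by
    rw [eq_div_iff (by positivity)]
    linear_combination 2 * (1 + m) * a2 + 2 * (1 - m) * a1
  set κ := m ^ 2 / (1 + m ^ 2) with hκ
  have hκ0 : 0 < κ := by positivity
  have hκ1 : κ * (1 + m ^ 2) = m ^ 2 := by rw [hκ]; field_simp
  -- On an arc of constant control `1`, `chatterX - chatterY ^ 2 / 2` is constant; this is its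
  -- value. After scaling by `l` it gives `b ^ 2 / 2 - σ * a = κ * (l * Y) ^ 2`, which determines `M
  -- = l * Y` below. The condition `r ∈ Ioc m 1` becomes `-m * M < -σ * b ≤ M`.
  have hC : X - Y ^ 2 / 2 = -κ * Y ^ 2 := by
    rw [hX, hY, hκ]; field_simp; ring
  -- a point on the correct branch lies on the arc
  have main : ∀ σ : ℝ, (σ = 1 ∨ σ = -1) → 0 < b ^ 2 / 2 - σ * a →
      (∀ M, 0 < M → κ * M ^ 2 = b ^ 2 / 2 - σ * a → -m * M < -σ * b ∧ -σ * b ≤ M) →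
      ∃ σ l r : ℝ, (σ = 1 ∨ σ = -1) ∧ 0 < l ∧ r ∈ Ioc m 1 ∧
        a = σ * l ^ 2 * chatterX m r ∧ b = -σ * l * chatterY m r := by
    intro σ hσ hpos hM
    have hσ2 : σ * σ = 1 := by rcases hσ with rfl | rfl <;> norm_num
    set M := √((b ^ 2 / 2 - σ * a) / κ) with hMdef
    have hMpos : 0 < M := Real.sqrt_pos.2 (div_pos hpos hκ0)
    have hM2 : κ * M ^ 2 = b ^ 2 / 2 - σ * a := by
      rw [hMdef, Real.sq_sqrt (div_pos hpos hκ0).le]; field_simp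
    obtain ⟨c1, c2⟩ := hM M hMpos hM2
    set l := M / Y with hl
    have hl0 : 0 < l := div_pos hMpos hY0
    have hlY : l * Y = M := by rw [hl]; field_simp
    set v := -σ * b / l with hv
    have hvl : v * l = -σ * b := by rw [hv]; field_simp
    have hv1 : -m * Y < v := by
      
      rw [hv, lt_div_iff₀ hl0, show -m * Y * l = -m * (l * Y) by ring, hlY]
      exact c1
    have hv2 : v ≤ Y := by rw [hv, div_le_iff₀ hl0]; linarith
    have hr : 1 - Y + v ∈ Ioc m 1 := ⟨by nlinarith, by linarith⟩
    have e1 : chatterY m (1 - Y + v) = v := by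
      rw [h1 _ (Ioc_subset_Icc_self hr)]; ring
    have e2 : chatterX m (1 - Y + v) = v ^ 2 / 2 - κ * Y ^ 2 := by
      rw [h2 _ (Ioc_subset_Icc_self hr)]; linear_combination hC
    refine ⟨σ, l, 1 - Y + v, hσ, hl0, hr, ?_, ?_⟩
    · rw [e2]
      have : l ^ 2 * (v ^ 2 / 2 - κ * Y ^ 2) = (v * l) ^ 2 / 2 - κ * (l * Y) ^ 2 := by ring
      rw [mul_assoc, this, hvl, hlY, hM2]
      linear_combination (-a) * hσ2 - σ * b ^ 2 / 2 * hσ2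
    · rw [e1]
      linear_combination σ * hvl - b * hσ2
  -- The parabola `a = (1 / 2 - κ) b²`, `b ≤ 0`, is the switching curve (`r = 1`, `σ = 1`); it
  -- separates the two signs of the control.
  rcases le_or_gt a ((1 / 2 - κ) * b ^ 2) with hle | hlt
  · refine main 1 (Or.inl rfl) ?_ fun M hM hM2 => ?_
    · rcases hb.eq_or_lt with h0 | hneg
      · have : a ≤ 0 := by rw [h0] at hle; linarith
        have := lt_of_le_of_ne this (hab h0)
        rw [h0]; linarith
      · nlinarith [mul_pos hκ0 (mul_pos_of_neg_of_neg hneg hneg)]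
    · refine ⟨by nlinarith, ?_⟩
      have : b ^ 2 ≤ M ^ 2 := by
        have : κ * b ^ 2 ≤ κ * M ^ 2 := by rw [hM2]; linarith
        exact le_of_mul_le_mul_left this hκ0
      have := abs_le_of_sq_le_sq' this hM.le
      linarith [this.1]
  · refine main (-1) (Or.inr rfl) ?_ fun M hM hM2 => ?_
    · have : κ < 1 := by rw [hκ, div_lt_one (by positivity)]; linarith
      nlinarith [mul_nonneg (sub_nonneg.2 this.le) (sq_nonneg b)]
    · refine ⟨?_, by linarith⟩
      have : b ^ 2 < (m * M) ^ 2 := by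
        have h3 : m ^ 2 * M ^ 2 = (1 + m ^ 2) * (b ^ 2 / 2 + a) := by
          linear_combination (1 + m ^ 2) * hM2 - M ^ 2 * hκ1
        have h4 : (1 + m ^ 2) * ((1 / 2 - κ) * b ^ 2) < (1 + m ^ 2) * a :=
          mul_lt_mul_of_pos_left hlt (by positivity)
        have h5 : (1 + m ^ 2) * ((1 / 2 - κ) * b ^ 2) = (1 - m ^ 2) / 2 * b ^ 2 := by
          linear_combination -b ^ 2 * hκ1
        rw [mul_pow, h3]
        nlinarith
      have := abs_lt_of_sq_lt_sq' this (by positivity)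
      linarith [this.1]

lemma exists_chatter_eq {m : ℝ} (hm : 0 < m) (hm1 : m < 1) {a b : ℝ} (hab : (a, b) ≠ (0, 0)) :
    ∃ σ l r : ℝ, (σ = 1 ∨ σ = -1) ∧ 0 < l ∧ r ∈ Ioc m 1 ∧
      a = σ * l ^ 2 * chatterX m r ∧ b = -σ * l * chatterY m r := by
  rcases le_or_gt b 0 with hb | hb
  · exact exists_chatter_eq_of_nonpos hm hm1 hb fun h0 ha => hab (by rw [h0, ha])
  · obtain ⟨σ, l, r, hσ, hl, hr, h1, h2⟩ := exists_chatter_eq_of_nonpos hm hm1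
      (a := -a) (b := -b) (by linarith) (fun h0 => absurd h0 (by linarith))
    refine ⟨-σ, l, r, ?_, hl, hr, by linear_combination -h1, by linear_combination -h2⟩
    rcases hσ with rfl | rfl <;> simp

/-- A trajectory of the Fuller problem at rest from the time `T` on, chattering before `T`,
together with the adjoint functions `p`, `q` that certify its optimality. -/
structure IsExtremal (a b T : ℝ) (x y u p q : ℝ → ℝ) : Prop where
  nonneg : 0 ≤ T
  measurable : Measurable u
  abs_le_one : ∀ t, |u t| ≤ 1
  y_eq : ∀ t, y t = b + ∫ s in (0 : ℝ)..t, u s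
  x_eq : ∀ t, x t = a + ∫ s in (0 : ℝ)..t, y s
  hasDerivAt_p : ∀ t, HasDerivAt p (x t) t
  hasDerivAt_q : ∀ t, HasDerivAt q (-p t) t
  rest : ∀ t, T ≤ t → x t = 0 ∧ y t = 0 ∧ u t = 0 ∧ p t = 0 ∧ q t = 0
  maximum : ∀ t, 0 ≤ t → 0 ≤ q t * u t
  abs_eq_one : ∀ t, 0 ≤ t → t < T → |u t| = 1
  chatter : (a, b) ≠ (0, 0) → ∃ (s : ℕ → ℝ) (σ : ℝ), s 0 = 0 ∧ StrictMono s ∧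
    Tendsto s atTop (𝓝 T) ∧ (σ = 1 ∨ σ = -1) ∧
    ∀ k : ℕ, ∀ t ∈ Ioo (s k) (s (k + 1)), u t = (-1) ^ k * σ

lemma exists_isExtremal (a b : ℝ) : ∃ (T : ℝ) (x y u p q : ℝ → ℝ), IsExtremal a b T x y u p q := by
  by_cases hab : (a, b) = (0, 0)
  · obtain ⟨rfl, rfl⟩ := Prod.mk.inj hab
    refine ⟨0, fun _ => 0, fun _ => 0, fun _ => 0, fun _ => 0, fun _ => 0,
      ⟨le_rfl, measurable_const, by simp, by simp, by simp, fun t => hasDerivAt_const t 0,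
        fun t => by simpa using hasDerivAt_const t (0 : ℝ), by simp, by simp,
        fun t h1 h2 => absurd h1 (not_le.2 h2), fun h => absurd rfl h⟩⟩
  obtain ⟨m, hm, hm1, hp⟩ := exists_ratio
  have hm0 : 0 < m := by linarith
  have hmlt : m < 1 := by linarith
  obtain ⟨σ, l, r, hσ, hl, hr, ha, hb⟩ := exists_chatter_eq hm0 hmlt hab
  have hr0 : 0 < r := hm0.trans hr.1
  have hσ2 : σ * σ = 1 := by rcases hσ with rfl | rfl <;> norm_num
  have hσ1 : |σ| = 1 := by rcases hσ with rfl | rfl <;> simp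
  have hd (t : ℝ) : HasDerivAt (fun t => r - t / l) (-(1 / l)) t :=
    ((hasDerivAt_id t).div_const l).const_sub r
  have hrt {t : ℝ} (ht : l * r ≤ t) : r - t / l ≤ 0 := by
    rw [sub_nonpos, le_div_iff₀ hl]; linarith
  have hint (f : ℝ → ℝ) (hf : ∀ a b, IntervalIntegrable f volume a b) (t : ℝ) :
      ∫ s in (0 : ℝ)..t, f (r - s / l) = l * (prim f r - prim f (r - t / l)) := by
    rw [intervalIntegral.integral_comp_sub_div _ hl.ne', prim, prim,
      intervalIntegral.integral_interval_sub_left (hf _ _) (hf _ _)]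
    simp
  -- Time runs backwards along the arc, slowed by `l`, and reaches the origin at `t = l * r`. Each
  -- integration brings a factor `l`, and each reversal of time a sign.
  refine ⟨l * r, fun t => σ * l ^ 2 * chatterX m (r - t / l),
    fun t => -σ * l * chatterY m (r - t / l), fun t => σ * chatterU m (r - t / l),
    fun t => -σ * l ^ 3 * chatterZ m (r - t / l), fun t => -σ * l ^ 4 * chatterW m (r - t / l),
    ⟨by positivity, ?_, ?_, ?_, ?_, ?_, ?_, ?_, ?_, ?_, ?_⟩⟩
  · exact ((measurable_chatterU m).comp (by fun_prop)).const_mul σ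
  · intro t
    simpa [abs_mul, hσ1] using abs_chatterU_le m (r - t / l)
  · intro t
    rw [intervalIntegral.integral_const_mul, hint _ (intervalIntegrable_chatterU m), hb]
    simp only [chatterY]; ring
  · intro t
    rw [intervalIntegral.integral_const_mul,
      hint _ (fun a b => (continuous_chatterY m).intervalIntegrable a b), ha]
    simp only [chatterX]; ring
  · intro t
    convert! ((hasDerivAt_prim (continuous_chatterX m) _).comp t (hd t)).const_mul (-σ * l ^ 3)
      using 1
    field_simp
  · intro t
    convert! ((hasDerivAt_prim (continuous_chatterZ m) _).comp t (hd t)).const_mul (-σ * l ^ 4)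
      using 1
    field_simp
  · intro t ht
    obtain ⟨h1, h2, h3, h4⟩ := chatter_of_nonpos m (hrt ht)
    simp [h1, h2, h3, h4, chatterU_of_nonpos m (hrt ht)]
  · intro t ht
    rcases le_or_gt (r - t / l) 0 with h | h
    · simp [chatterU_of_nonpos m h]
    · have := chatterW_mul_chatterU_nonpos hm hm1 hp (r := r - t / l)
        ⟨h, by linarith [hr.2, div_nonneg ht hl.le]⟩
      calc 0 ≤ l ^ 4 * (-(chatterW m (r - t / l) * chatterU m (r - t / l))) := by
            have : 0 ≤ -(chatterW m (r - t / l) * chatterU m (r - t / l)) := by linarith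
            positivity
        _ = _ := by
          linear_combination (l ^ 4 * (chatterW m (r - t / l) * chatterU m (r - t / l))) * hσ2
  · intro t _ ht
    have h : 0 < r - t / l := by rw [sub_pos, div_lt_iff₀ hl]; linarith
    simp [abs_mul, hσ1, abs_chatterU_of_pos m h]
  · intro _
    -- The formula at `k = 0` would give `l * (r - 1) ≤ 0`, a switch no later than the start; it is
    -- replaced by the initial time.
    refine ⟨fun k => if k = 0 then 0 else l * (r - m ^ k), σ, by simp, ?_, ?_, hσ, ?_⟩
    · refine strictMono_nat_of_lt_succ fun k => ?_
      rcases k with _ | k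
      · simp only [if_true, zero_add, one_ne_zero, if_false, pow_one]
        exact mul_pos hl (sub_pos.2 hr.1)
      · simp only [Nat.add_eq_zero_iff, one_ne_zero, and_false, if_false]
        have : m ^ (k + 1 + 1) < m ^ (k + 1) := pow_lt_pow_right_of_lt_one₀ hm0 hmlt (by omega)
        exact mul_lt_mul_of_pos_left (by linarith) hl
    · have h1 : Tendsto (fun k : ℕ => l * (r - m ^ k)) atTop (𝓝 (l * (r - 0))) :=
        ((tendsto_pow_atTop_nhds_zero_of_lt_one hm0.le hmlt).const_sub r).const_mul l
      rw [sub_zero] at h1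
      refine h1.congr' ?_
      filter_upwards [eventually_gt_atTop 0] with k hk
      simp [hk.ne']
    · intro k t ht
      have h1 : m ^ (k + 1) < r - t / l := by
        have := ht.2
        simp only [Nat.add_eq_zero_iff, one_ne_zero, and_false, if_false] at this
        rw [lt_sub_comm, div_lt_iff₀ hl]; linarith
      have h2 : r - t / l ≤ m ^ k := by
        rw [sub_le_comm, le_div_iff₀ hl]
        have := ht.1
        rcases k with _ | k
        · simp only [if_true] at this
          have : (r - m ^ 0) * l ≤ 0 :=
            mul_nonpos_of_nonpos_of_nonneg (by rw [pow_zero]; linarith [hr.2]) hl.le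
          linarith
        · simp only [Nat.add_eq_zero_iff, one_ne_zero, and_false, if_false] at this
          linarith
      simp only [chatterU_eq hm0 hmlt h1 h2]
      ring

/-! ### Absolutely continuous functions -/

lemma absolutelyContinuousOnInterval_of_abs_sub_le {f : ℝ → ℝ} {a b C : ℝ} (hab : a ≤ b)
    (h : ∀ s ∈ Icc a b, ∀ t ∈ Icc a b, |f s - f t| ≤ C * |s - t|) :
    AbsolutelyContinuousOnInterval f a b := by
  refine LipschitzOnWith.absolutelyContinuousOnInterval (K := C.toNNReal) ?_
  rw [uIcc_of_le hab]
  refine LipschitzOnWith.of_dist_le_mul fun s hs t ht => ?_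
  rw [Real.dist_eq, Real.dist_eq]
  exact (h s hs t ht).trans (mul_le_mul_of_nonneg_right (Real.le_coe_toNNReal C) (abs_nonneg _))

lemma abs_sub_le_of_eq_integral {f g : ℝ → ℝ} {c T C : ℝ}
    (hf : IntervalIntegrable f volume 0 T) (hC : ∀ᵐ t, t ∈ Icc 0 T → |f t| ≤ C)
    (h : ∀ t ∈ Icc 0 T, g t = c + ∫ s in (0 : ℝ)..t, f s) :
    ∀ s ∈ Icc 0 T, ∀ t ∈ Icc 0 T, |g s - g t| ≤ C * |s - t| := by
  intro s hs t ht
  have hi : ∀ t ∈ Icc 0 T, IntervalIntegrable f volume 0 t := fun t ht =>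
    hf.mono_set (by rw [uIcc_of_le ht.1, uIcc_of_le (ht.1.trans ht.2)]
                    exact Icc_subset_Icc_right ht.2)
  rw [h s hs, h t ht, add_sub_add_left_eq_sub,
    intervalIntegral.integral_interval_sub_left (hi s hs) (hi t ht)]
  refine intervalIntegral.norm_integral_le_of_norm_le_const_ae (f := f) ?_
  filter_upwards [hC] with r hr hrm
  refine hr ?_
  rcases mem_uIoc.1 hrm with h' | h'
  · exact ⟨ht.1.trans h'.1.le, h'.2.trans hs.2⟩
  · exact ⟨hs.1.trans h'.1.le, h'.2.trans ht.2⟩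

lemma continuousOn_of_abs_sub_le {f : ℝ → ℝ} {a b C : ℝ} (hab : a ≤ b)
    (h : ∀ s ∈ Icc a b, ∀ t ∈ Icc a b, |f s - f t| ≤ C * |s - t|) : ContinuousOn f (Icc a b) := by
  have := (absolutelyContinuousOnInterval_of_abs_sub_le hab h).continuousOn
  rwa [uIcc_of_le hab] at this

lemma abs_sub_le_of_hasDerivAt {f f' : ℝ → ℝ} {a b C : ℝ} (hf : ∀ t, HasDerivAt f (f' t) t)
    (hC : ∀ t ∈ Icc a b, |f' t| ≤ C) :
    ∀ s ∈ Icc a b, ∀ t ∈ Icc a b, |f s - f t| ≤ C * |s - t| := fun _ hs _ ht =>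
  (convex_Icc a b).norm_image_sub_le_of_norm_hasDerivWithin_le
    (fun r _ => (hf r).hasDerivWithinAt) hC ht hs

lemma absolutelyContinuousOnInterval_of_hasDerivAt {f f' : ℝ → ℝ} {a b : ℝ} (hab : a ≤ b)
    (hf : ∀ t, HasDerivAt f (f' t) t) (hf' : ContinuousOn f' (Icc a b)) :
    AbsolutelyContinuousOnInterval f a b := by
  obtain ⟨C, hC⟩ := isCompact_Icc.exists_bound_of_continuousOn hf'
  exact absolutelyContinuousOnInterval_of_abs_sub_le hab (abs_sub_le_of_hasDerivAt hf hC)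

lemma ae_mem_Ioo_of_mem_Icc (a b : ℝ) : ∀ᵐ t : ℝ, t ∈ Icc a b → t ∈ Ioo a b := by
  have h1 : ∀ᵐ t : ℝ, t ≠ a := by simp [ae_iff, measure_singleton]
  have h2 : ∀ᵐ t : ℝ, t ≠ b := by simp [ae_iff, measure_singleton]
  filter_upwards [h1, h2] with t ha hb ht
  exact ⟨lt_of_le_of_ne ht.1 ha.symm, lt_of_le_of_ne ht.2 hb⟩

/-! ### Trajectories on a bounded interval -/

section Trajectory

variable {I J : Set ℝ} {T a b : ℝ} {x y u : ℝ → ℝ}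

lemma IsTrajectory.mono (h : IsTrajectory I a b x y u) (hJ : J ⊆ I) :
    IsTrajectory J a b x y u :=
  ⟨h.aemeasurable.mono_measure (Measure.restrict_mono hJ le_rfl),
    ae_mono (Measure.restrict_mono hJ le_rfl) h.abs_le_one,
    fun t ht => h.y_eq t (hJ ht), fun t ht => h.x_eq t (hJ ht)⟩

lemma IsTrajectory.intervalIntegrable (h : IsTrajectory (Icc 0 T) a b x y u) (hT : 0 ≤ T) :
    IntervalIntegrable u volume 0 T := by
  rw [intervalIntegrable_iff_integrableOn_Icc_of_le hT]
  exact ⟨h.aemeasurable.aestronglyMeasurable,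
    .restrict_of_bounded (C := 1) (measure_Icc_lt_top) h.abs_le_one⟩

lemma IsTrajectory.abs_sub_le_y (h : IsTrajectory (Icc 0 T) a b x y u) (hT : 0 ≤ T) :
    ∀ s ∈ Icc 0 T, ∀ t ∈ Icc 0 T, |y s - y t| ≤ 1 * |s - t| :=
  abs_sub_le_of_eq_integral (h.intervalIntegrable hT)
    ((ae_restrict_iff' measurableSet_Icc).1 h.abs_le_one) h.y_eq

lemma IsTrajectory.continuousOn_y (h : IsTrajectory (Icc 0 T) a b x y u) (hT : 0 ≤ T) :
    ContinuousOn y (Icc 0 T) := continuousOn_of_abs_sub_le hT (h.abs_sub_le_y hT)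

lemma IsTrajectory.exists_abs_sub_le_x (h : IsTrajectory (Icc 0 T) a b x y u) (hT : 0 ≤ T) :
    ∃ C, ∀ s ∈ Icc 0 T, ∀ t ∈ Icc 0 T, |x s - x t| ≤ C * |s - t| := by
  obtain ⟨C, hC⟩ := isCompact_Icc.exists_bound_of_continuousOn (h.continuousOn_y hT)
  exact ⟨C, abs_sub_le_of_eq_integral
    ((h.continuousOn_y hT).intervalIntegrable_of_Icc hT) (Eventually.of_forall hC) h.x_eq⟩

lemma IsTrajectory.continuousOn_x (h : IsTrajectory (Icc 0 T) a b x y u) (hT : 0 ≤ T) :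
    ContinuousOn x (Icc 0 T) := by
  obtain ⟨C, hC⟩ := h.exists_abs_sub_le_x hT
  exact continuousOn_of_abs_sub_le hT hC

lemma IsTrajectory.hasDerivAt_x (h : IsTrajectory (Icc 0 T) a b x y u) {t : ℝ}
    (ht : t ∈ Ioo 0 T) : HasDerivAt x (y t) t := by
  have hT : 0 ≤ T := (ht.1.trans ht.2).le
  have hc := h.continuousOn_y hT
  have h1 : HasDerivAt (fun t => a + ∫ s in (0 : ℝ)..t, y s) (y t) t := by
    refine HasDerivAt.const_add a (intervalIntegral.integral_hasDerivAt_right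
      ((hc.mono (Icc_subset_Icc_right ht.2.le)).intervalIntegrable_of_Icc ht.1.le) ?_
      (hc.continuousAt (Icc_mem_nhds ht.1 ht.2)))
    exact (hc.mono Ioo_subset_Icc_self).stronglyMeasurableAtFilter isOpen_Ioo t ht
  refine h1.congr_of_eventuallyEq ?_
  filter_upwards [Icc_mem_nhds ht.1 ht.2] with s hs using h.x_eq s hs

lemma IsTrajectory.ae_hasDerivAt_y (h : IsTrajectory (Icc 0 T) a b x y u) (hT : 0 ≤ T) :
    ∀ᵐ t, t ∈ Ioo 0 T → HasDerivAt y (u t) t := by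
  filter_upwards [(h.intervalIntegrable hT).ae_hasDerivAt_integral] with t ht htm
  rw [uIcc_of_le hT] at ht
  refine ((ht (Ioo_subset_Icc_self htm) 0 ⟨le_rfl, hT⟩).const_add b).congr_of_eventuallyEq ?_
  filter_upwards [Icc_mem_nhds htm.1 htm.2] with s hs using h.y_eq s hs

/-- Two trajectories with the same first component coincide. -/
lemma IsTrajectory.eqOn_y {x' y' u' : ℝ → ℝ} (h : IsTrajectory (Icc 0 T) a b x y u)
    (h' : IsTrajectory (Icc 0 T) a b x' y' u') (hT : 0 ≤ T) (hx : EqOn x x' (Icc 0 T)) :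
    EqOn y y' (Icc 0 T) := by
  have h0 : EqOn y y' (Ioo 0 T) := fun t ht => by
    refine (h.hasDerivAt_x ht).unique ((h'.hasDerivAt_x ht).congr_of_eventuallyEq ?_)
    filter_upwards [Icc_mem_nhds ht.1 ht.2] with s hs using hx hs
  rcases hT.eq_or_lt with rfl | hpos
  · intro t ht
    rw [Icc_self, mem_singleton_iff] at ht
    subst ht
    simp [h.y_eq 0 (by simp), h'.y_eq 0 (by simp)]
  · rw [← closure_Ioo hpos.ne]
    exact h0.of_subset_closure ((h.continuousOn_y hT).mono (closure_Ioo hpos.ne).le)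
      ((h'.continuousOn_y hT).mono (closure_Ioo hpos.ne).le) subset_closure le_rfl

lemma IsTrajectory.ae_eq_u {x' y' u' : ℝ → ℝ} (h : IsTrajectory (Icc 0 T) a b x y u)
    (h' : IsTrajectory (Icc 0 T) a b x' y' u') (hT : 0 ≤ T) (hy : EqOn y y' (Icc 0 T)) :
    ∀ᵐ t, t ∈ Icc 0 T → u t = u' t := by
  filter_upwards [h.ae_hasDerivAt_y hT, h'.ae_hasDerivAt_y hT, ae_mem_Ioo_of_mem_Icc 0 T]
    with t h1 h2 h3 ht
  refine (h1 (h3 ht)).unique ((h2 (h3 ht)).congr_of_eventuallyEq ?_)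
  filter_upwards [Icc_mem_nhds (h3 ht).1 (h3 ht).2] with s hs using hy hs

/-- The maximum principle with normal multiplier is sufficient for optimality, with quadratic
growth of the cost. -/
lemma integral_sq_add_integral_sq_sub_le {x' y' u' p q : ℝ → ℝ} (hT : 0 ≤ T)
    (h : IsTrajectory (Icc 0 T) a b x y u) (h' : IsTrajectory (Icc 0 T) a b x' y' u')
    (hp : ∀ t, HasDerivAt p (x t) t) (hq : ∀ t, HasDerivAt q (-p t) t)
    (hmax : ∀ t ∈ Icc 0 T, q t * u t = |q t|) (hpT : p T * (x' T - x T) = 0)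
    (hqT : q T * (y' T - y T) = 0) :
    (∫ t in (0 : ℝ)..T, x t ^ 2) + ∫ t in (0 : ℝ)..T, (x' t - x t) ^ 2
      ≤ ∫ t in (0 : ℝ)..T, x' t ^ 2 := by
  have cx := h.continuousOn_x hT
  have cx' := h'.continuousOn_x hT
  have cp : Continuous p := continuous_iff_continuousAt.2 fun t => (hp t).continuousAt
  have acp := absolutelyContinuousOnInterval_of_hasDerivAt hT hp cx
  have acq := absolutelyContinuousOnInterval_of_hasDerivAt hT hq cp.neg.continuousOn
  obtain ⟨C, hC⟩ := h.exists_abs_sub_le_x hT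
  obtain ⟨C', hC'⟩ := h'.exists_abs_sub_le_x hT
  have acx := (absolutelyContinuousOnInterval_of_abs_sub_le hT hC').sub
    (absolutelyContinuousOnInterval_of_abs_sub_le hT hC)
  have acy := (absolutelyContinuousOnInterval_of_abs_sub_le hT (h'.abs_sub_le_y hT)).sub
    (absolutelyContinuousOnInterval_of_abs_sub_le hT (h.abs_sub_le_y hT))
  have acF := (acp.mul acx).add (acq.mul acy)
  have hF := acF.integral_deriv_eq_sub
  have h00 : (0 : ℝ) ∈ Icc 0 T := ⟨le_rfl, hT⟩
  have hF0 : (p * (x' - x) + q * (y' - y)) T - (p * (x' - x) + q * (y' - y)) 0 = 0 := by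
    simp [hpT, hqT, h.x_eq 0 h00, h.y_eq 0 h00, h'.x_eq 0 h00, h'.y_eq 0 h00]
  rw [hF0] at hF
  have hu : ∀ᵐ t, t ∈ Icc 0 T → |u' t| ≤ 1 := (ae_restrict_iff' measurableSet_Icc).1 h'.abs_le_one
  -- By the adjoint equations the terms `p (y' - y)` cancel, leaving `x (x' - x) + q (u' - u)`, and
  -- `q u' ≤ |q| = q u`.
  have hle : ∀ᵐ t, t ∈ Icc 0 T →
      deriv (p * (x' - x) + q * (y' - y)) t ≤ x t * (x' t - x t) := by
    filter_upwards [h.ae_hasDerivAt_y hT, h'.ae_hasDerivAt_y hT, hu, ae_mem_Ioo_of_mem_Icc 0 T]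
      with t h1 h2 h3 h4 ht
    have hd := ((hp t).mul ((h'.hasDerivAt_x (h4 ht)).sub (h.hasDerivAt_x (h4 ht)))).add
      ((hq t).mul ((h2 (h4 ht)).sub (h1 (h4 ht))))
    rw [hd.deriv]
    have h5 : q t * u' t ≤ q t * u t := by
      rw [hmax t ht]
      calc q t * u' t ≤ |q t * u' t| := le_abs_self _
        _ = |q t| * |u' t| := abs_mul _ _
        _ ≤ |q t| := mul_le_of_le_one_right (abs_nonneg _) (h3 ht)
    simp only [Pi.sub_apply]
    linarith
  have i1 : IntervalIntegrable (fun t => x t * (x' t - x t)) volume 0 T :=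
    (cx.mul (cx'.sub cx)).intervalIntegrable_of_Icc hT
  have h6 : 0 ≤ ∫ t in (0 : ℝ)..T, x t * (x' t - x t) := by
    refine hF.symm.le.trans ?_
    exact intervalIntegral.integral_mono_ae_restrict hT acF.intervalIntegrable_deriv i1
      ((ae_restrict_iff' measurableSet_Icc).2 hle)
  have h7 : ∫ t in (0 : ℝ)..T, x' t ^ 2 = (∫ t in (0 : ℝ)..T, x t ^ 2)
      + (∫ t in (0 : ℝ)..T, (x' t - x t) ^ 2)
      + 2 * ∫ t in (0 : ℝ)..T, x t * (x' t - x t) := by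
    rw [← intervalIntegral.integral_const_mul, ← intervalIntegral.integral_add,
      ← intervalIntegral.integral_add]
    · exact intervalIntegral.integral_congr fun t _ => by ring
    · exact ((cx.pow 2).add ((cx'.sub cx).pow 2)).intervalIntegrable_of_Icc hT
    · exact i1.const_mul 2
    · exact (cx.pow 2).intervalIntegrable_of_Icc hT
    · exact ((cx'.sub cx).pow 2).intervalIntegrable_of_Icc hT
  linarith

lemma eqOn_of_integral_sq_sub_nonpos {f g : ℝ → ℝ} (hT : 0 < T) (hf : ContinuousOn f (Icc 0 T))
    (hg : ContinuousOn g (Icc 0 T)) (h : ∫ t in (0 : ℝ)..T, (f t - g t) ^ 2 ≤ 0) :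
    EqOn f g (Icc 0 T) := by
  by_contra hne
  simp only [EqOn, not_forall] at hne
  obtain ⟨t, ht, hne⟩ := hne
  have := intervalIntegral.integral_pos hT ((hf.sub hg).pow 2) (fun s _ => sq_nonneg _)
    ⟨t, ht, (sq_pos_of_ne_zero (sub_ne_zero.2 hne))⟩
  exact absurd this (not_lt.2 h)

end Trajectory

/-! ### The Fuller problem on the half line -/

lemma setLIntegral_Icc_eq {x : ℝ → ℝ} {S : ℝ} (hS : 0 ≤ S) (hx : ContinuousOn x (Icc 0 S)) :
    ∫⁻ t in Icc 0 S, ENNReal.ofReal (x t ^ 2 / 2)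
      = ENNReal.ofReal ((1 / 2) * ∫ t in (0 : ℝ)..S, x t ^ 2) := by
  rw [← intervalIntegral.integral_const_mul, intervalIntegral.integral_of_le hS,
    ← integral_Icc_eq_integral_Ioc, ofReal_integral_eq_lintegral_ofReal]
  · exact lintegral_congr fun t => by ring_nf
  · exact (continuousOn_const.mul (hx.pow 2)).integrableOn_Icc
  · exact Eventually.of_forall fun t => by positivity

section Extremal

variable {a b T : ℝ} {x y u p q : ℝ → ℝ}

lemma IsExtremal.isTrajectory (h : IsExtremal a b T x y u p q) (I : Set ℝ) :
    IsTrajectory I a b x y u :=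
  ⟨h.measurable.aemeasurable, Eventually.of_forall h.abs_le_one, fun t _ => h.y_eq t,
    fun t _ => h.x_eq t⟩

lemma IsExtremal.mul_eq_abs (h : IsExtremal a b T x y u p q) {t : ℝ} (ht : 0 ≤ t) :
    q t * u t = |q t| := by
  rcases lt_or_ge t T with h1 | h1
  · rw [← abs_of_nonneg (h.maximum t ht), abs_mul, h.abs_eq_one t ht h1, mul_one]
  · simp [h.rest t h1]

lemma IsExtremal.integral_sq_add_le (h : IsExtremal a b T x y u p q) {S : ℝ} (hS : T ≤ S)
    {x' y' u' : ℝ → ℝ} (h' : IsTrajectory (Icc 0 S) a b x' y' u') :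
    (∫ t in (0 : ℝ)..S, x t ^ 2) + ∫ t in (0 : ℝ)..S, (x' t - x t) ^ 2
      ≤ ∫ t in (0 : ℝ)..S, x' t ^ 2 := by
  obtain ⟨-, -, -, h1, h2⟩ := h.rest S hS
  exact integral_sq_add_integral_sq_sub_le (h.nonneg.trans hS) (h.isTrajectory _) h'
    h.hasDerivAt_p h.hasDerivAt_q (fun t ht => h.mul_eq_abs ht.1) (by simp [h1]) (by simp [h2])

lemma IsExtremal.continuousOn (h : IsExtremal a b T x y u p q) {S : ℝ} (hS : 0 ≤ S) :
    ContinuousOn x (Icc 0 S) := (h.isTrajectory _).continuousOn_x hS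

lemma IsExtremal.integral_sq_eq (h : IsExtremal a b T x y u p q) {S : ℝ} (hS : T ≤ S) :
    ∫ t in (0 : ℝ)..S, x t ^ 2 = ∫ t in (0 : ℝ)..T, x t ^ 2 := by
  have hc : ContinuousOn (fun t => x t ^ 2) (Icc 0 S) :=
    (h.continuousOn (h.nonneg.trans hS)).pow 2
  rw [← intervalIntegral.integral_add_adjacent_intervals (b := T)
    ((hc.mono (Icc_subset_Icc_right hS)).intervalIntegrable_of_Icc h.nonneg)
    ((hc.mono (Icc_subset_Icc_left h.nonneg)).intervalIntegrable_of_Icc hS)]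
  rw [intervalIntegral.integral_congr (a := T) (b := S) (g := fun _ => 0)]
  · simp
  · intro t ht
    rw [uIcc_of_le hS] at ht
    simp [(h.rest t ht.1).1]

lemma IsExtremal.cost_eq (h : IsExtremal a b T x y u p q) :
    cost x = ENNReal.ofReal ((1 / 2) * ∫ t in (0 : ℝ)..T, x t ^ 2) := by
  rw [← setLIntegral_Icc_eq h.nonneg (h.continuousOn h.nonneg), cost,
    ← Icc_union_Ioi_eq_Ici h.nonneg, lintegral_union measurableSet_Ioi
      (disjoint_left.2 fun t h1 h2 => absurd h1.2 (not_le.2 h2))]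
  rw [setLIntegral_congr_fun (g := fun _ => 0) measurableSet_Ioi]
  · simp
  · intro t ht
    simp [(h.rest t (le_of_lt ht)).1]

lemma IsTrajectory.ofReal_le_cost {x' y' u' : ℝ → ℝ} (h' : IsTrajectory (Ici 0) a b x' y' u')
    {S : ℝ} (hS : 0 ≤ S) :
    ENNReal.ofReal ((1 / 2) * ∫ t in (0 : ℝ)..S, x' t ^ 2) ≤ cost x' := by
  rw [← setLIntegral_Icc_eq hS ((h'.mono Icc_subset_Ici_self).continuousOn_x hS)]
  exact lintegral_mono_set Icc_subset_Ici_self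

lemma IsExtremal.isOptimal (h : IsExtremal a b T x y u p q) : IsOptimal a b x y u := by
  refine ⟨h.isTrajectory _, fun x' y' u' h' => ?_⟩
  rw [h.cost_eq]
  refine le_trans (ENNReal.ofReal_le_ofReal ?_) (h'.ofReal_le_cost h.nonneg)
  have h1 := h.integral_sq_add_le le_rfl (h'.mono Icc_subset_Ici_self)
  have h2 : 0 ≤ ∫ t in (0 : ℝ)..T, (x' t - x t) ^ 2 :=
    intervalIntegral.integral_nonneg h.nonneg fun t _ => sq_nonneg _
  linarith

lemma IsExtremal.JF_eq (h : IsExtremal a b T x y u p q) :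
    JF a b = (1 / 2) * ∫ t in (0 : ℝ)..T, x t ^ 2 := by
  have : IsLeast {c : ℝ≥0∞ | ∃ x y u : ℝ → ℝ, IsTrajectory (Ici 0) a b x y u ∧ c = cost x}
      (cost x) := by
    refine ⟨⟨x, y, u, h.isTrajectory _, rfl⟩, ?_⟩
    rintro c ⟨x', y', u', h', rfl⟩
    exact h.isOptimal.2 x' y' u' h'
  rw [JF, this.csInf_eq, h.cost_eq, ENNReal.toReal_ofReal]
  exact mul_nonneg (by norm_num) (intervalIntegral.integral_nonneg h.nonneg fun t _ => sq_nonneg _)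

/-- On `[0, S]` a competing optimum costs no more than the extremal, so quadratic growth forces `∫
(x' - x)² ≤ 0`. -/
lemma IsExtremal.eqOn_of_isOptimal (h : IsExtremal a b T x y u p q) {x' y' u' : ℝ → ℝ}
    (h' : IsOptimal a b x' y' u') {S : ℝ} (hS : T ≤ S) (hS0 : 0 < S) :
    EqOn x' x (Icc 0 S) ∧ EqOn y' y (Icc 0 S) := by
  have t' : IsTrajectory (Icc 0 S) a b x' y' u' := h'.1.mono Icc_subset_Ici_self
  have h1 : (1 / 2) * ∫ t in (0 : ℝ)..S, x' t ^ 2 ≤ (1 / 2) * ∫ t in (0 : ℝ)..T, x t ^ 2 := by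
    have := (h'.1.ofReal_le_cost hS0.le).trans (h'.2 x y u (h.isTrajectory _))
    rw [h.cost_eq, ENNReal.ofReal_le_ofReal_iff] at this
    · exact this
    · exact mul_nonneg (by norm_num)
        (intervalIntegral.integral_nonneg h.nonneg fun t _ => sq_nonneg _)
  have h2 := h.integral_sq_add_le hS t'
  rw [h.integral_sq_eq hS] at h2
  have hx : EqOn x' x (Icc 0 S) := eqOn_of_integral_sq_sub_nonpos hS0
    (t'.continuousOn_x hS0.le) (h.continuousOn hS0.le) (by linarith)
  exact ⟨hx, t'.eqOn_y (h.isTrajectory _) hS0.le hx⟩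

/-- Any optimal trajectory agrees with the extremal on `[0, T]`. Rest from an earlier time would
make `y` vanish on an interval before `T`, hence `u = 0` almost everywhere there, against `|u| = 1`.
-/
lemma IsExtremal.TF_eq (h : IsExtremal a b T x y u p q) : TF a b = T := by
  refine IsLeast.csInf_eq ⟨⟨h.nonneg, x, y, u, h.isOptimal,
    fun t ht => ⟨(h.rest t ht).1, (h.rest t ht).2.1⟩⟩, ?_⟩
  rintro T' ⟨hT', x', y', u', h', hrest⟩
  by_contra! hlt
  have hT : 0 < T := hT'.trans_lt hlt
  have heq := (h.eqOn_of_isOptimal h' le_rfl hT).2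
  have hae : ∀ᵐ t, t ∉ Ioo T' T := by
    filter_upwards [(h.isTrajectory (Icc 0 T)).ae_hasDerivAt_y hT.le] with t ht htm
    have htm' : t ∈ Ioo 0 T := ⟨hT'.trans_lt htm.1, htm.2⟩
    have h0 : HasDerivAt y 0 t := by
      refine (hasDerivAt_const t (0 : ℝ)).congr_of_eventuallyEq ?_
      filter_upwards [Ioo_mem_nhds htm.1 htm.2] with s hs
      rw [← heq ⟨hT'.trans hs.1.le, hs.2.le⟩]
      exact (hrest s hs.1.le).2
    have h1 := h.abs_eq_one t htm'.1.le htm'.2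
    rw [(ht htm').unique h0] at h1
    simp at h1
  have h0 : volume (Ioo T' T) = 0 := measure_eq_zero_iff_ae_notMem.2 hae
  rw [Real.volume_Ioo, ENNReal.ofReal_eq_zero] at h0
  linarith

end Extremal

/-! ### The Fuller problem with both endpoints fixed -/

section Finite

variable {a b a' b' T T' S : ℝ} {x y u p q x' y' u' p' q' : ℝ → ℝ}

lemma integral_comp_const_sub_eq {f g : ℝ → ℝ} {c S : ℝ}
    (hf : ∀ s t, IntervalIntegrable f volume s t)
    (h : ∀ t, g t = c + ∫ s in (0 : ℝ)..t, f s) (t : ℝ) :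
    ∫ s in (0 : ℝ)..t, f (S - s) = g S - g (S - t) := by
  rw [intervalIntegral.integral_comp_sub_left, sub_zero, h S, h (S - t),
    ← intervalIntegral.integral_interval_sub_left (hf 0 S) (hf 0 (S - t))]
  ring

lemma IsExtremal.intervalIntegrable (h : IsExtremal a b T x y u p q) (s t : ℝ) :
    IntervalIntegrable u volume s t :=
  (intervalIntegrable_const (c := (1 : ℝ))).mono_fun h.measurable.aestronglyMeasurable
    (Eventually.of_forall fun r => by simpa using h.abs_le_one r)

lemma IsExtremal.continuous_y (h : IsExtremal a b T x y u p q) : Continuous y := by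
  rw [funext h.y_eq]
  exact continuous_const.add (intervalIntegral.continuous_primitive h.intervalIntegrable 0)

lemma IsExtremal.continuous_x (h : IsExtremal a b T x y u p q) : Continuous x := by
  rw [funext h.x_eq]
  exact continuous_const.add (intervalIntegral.continuous_primitive
    (fun s t => h.continuous_y.intervalIntegrable s t) 0)

/-- The supports of the two halves of a concatenation are disjoint. -/
lemma IsExtremal.rest_or (h : IsExtremal a b T x y u p q) (h' : IsExtremal a' b' T' x' y' u' p' q')
    (hS : T + T' ≤ S) (t : ℝ) :
    (x t = 0 ∧ y t = 0 ∧ u t = 0 ∧ p t = 0 ∧ q t = 0) ∨ (x' (S - t) = 0 ∧ y' (S - t) = 0 ∧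
      u' (S - t) = 0 ∧ p' (S - t) = 0 ∧ q' (S - t) = 0) := by
  rcases le_or_gt T t with ht | ht
  · exact Or.inl (h.rest t ht)
  · exact Or.inr (h'.rest _ (by linarith))

/-- Time reversal preserves `x` and `u` and changes the sign of `y`, whence `-b'`. A sum replaces a
definition by cases, because at every time one of the two summands is at rest. -/
lemma IsExtremal.isFiniteTrajectory_concat (h : IsExtremal a b T x y u p q)
    (h' : IsExtremal a' (-b') T' x' y' u' p' q') (hS : T + T' ≤ S) :
    IsFiniteTrajectory S a b a' b' (fun t => x t + x' (S - t)) (fun t => y t - y' (S - t))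
      (fun t => u t + u' (S - t)) := by
  have hT := h.nonneg
  have hT' := h'.nonneg
  have r := h.rest S (by linarith)
  have r' := h'.rest S (by linarith)
  have e : x' 0 = a' := by simp [h'.x_eq 0]
  have e' : y' 0 = -b' := by simp [h'.y_eq 0]
  refine ⟨⟨?_, Eventually.of_forall fun t => ?_, fun t _ => ?_, fun t _ => ?_⟩, ?_, ?_⟩
  · exact (h.measurable.add (h'.measurable.comp (by fun_prop))).aemeasurable
  · rcases h.rest_or h' hS t with h1 | h1
    · simpa [h1] using h'.abs_le_one _
    · simpa [h1] using h.abs_le_one _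
  · rw [intervalIntegral.integral_add (h.intervalIntegrable 0 t)
      (by simpa using (h'.intervalIntegrable S (S - t)).comp_sub_left S),
      integral_comp_const_sub_eq h'.intervalIntegrable h'.y_eq, r'.2.1, h.y_eq t]
    ring
  · have hy' : Continuous fun s => y' (S - s) := h'.continuous_y.comp (by fun_prop)
    rw [intervalIntegral.integral_sub (h.continuous_y.intervalIntegrable 0 t)
      (hy'.intervalIntegrable 0 t),
      integral_comp_const_sub_eq (fun s t => h'.continuous_y.intervalIntegrable s t) h'.x_eq,
      r'.1, h.x_eq t]
    ring
  · simp [r.1, e]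
  · simp [r.2.1, e']

lemma IsExtremal.integral_concat (h : IsExtremal a b T x y u p q)
    (h' : IsExtremal a' b' T' x' y' u' p' q') (hS : T + T' ≤ S) :
    (1 / 2) * ∫ t in (0 : ℝ)..S, (x t + x' (S - t)) ^ 2 = JF a b + JF a' b' := by
  have hT := h.nonneg
  have hT' := h'.nonneg
  have h1 : ∫ t in (0 : ℝ)..S, (x t + x' (S - t)) ^ 2
      = ∫ t in (0 : ℝ)..S, (x t ^ 2 + x' (S - t) ^ 2) :=
    intervalIntegral.integral_congr fun t _ => by
      rcases h.rest_or h' hS t with h1 | h1 <;> simp [h1]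
  have hx : Continuous fun t => x t ^ 2 := h.continuous_x.pow 2
  have hx' : Continuous fun t => x' (S - t) ^ 2 :=
    (h'.continuous_x.comp (by fun_prop : Continuous fun s : ℝ => S - s)).pow 2
  rw [h1, intervalIntegral.integral_add (hx.intervalIntegrable 0 S) (hx'.intervalIntegrable 0 S),
    intervalIntegral.integral_comp_sub_left (fun t => x' t ^ 2), sub_self, sub_zero,
    h.JF_eq, h'.JF_eq, h.integral_sq_eq (by linarith), h'.integral_sq_eq (by linarith)]
  ring

/-- The adjoints are concatenated as well: under time reversal `p` changes sign and `q` does not.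
The terminal terms of the maximum principle vanish because both trajectories share their endpoint.
-/
lemma IsExtremal.integral_concat_add_le (h : IsExtremal a b T x y u p q)
    (h' : IsExtremal a' (-b') T' x' y' u' p' q') (hS : T + T' ≤ S) {X Y U : ℝ → ℝ}
    (H : IsFiniteTrajectory S a b a' b' X Y U) :
    (∫ t in (0 : ℝ)..S, (x t + x' (S - t)) ^ 2)
      + ∫ t in (0 : ℝ)..S, (X t - (x t + x' (S - t))) ^ 2 ≤ ∫ t in (0 : ℝ)..S, X t ^ 2 := by
  have hT := h.nonneg
  have hT' := h'.nonneg
  have hc := h.isFiniteTrajectory_concat h' hS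
  have hd (t : ℝ) : HasDerivAt (fun t => S - t) (-1) t := (hasDerivAt_id t).const_sub S
  refine integral_sq_add_integral_sq_sub_le (p := fun t => p t - p' (S - t))
    (q := fun t => q t + q' (S - t)) (by linarith) hc.1 H.1 (fun t => ?_) (fun t => ?_)
    (fun t ht => ?_) ?_ ?_
  · convert! (h.hasDerivAt_p t).sub ((h'.hasDerivAt_p (S - t)).comp t (hd t)) using 1
    ring
  · convert! (h.hasDerivAt_q t).add ((h'.hasDerivAt_q (S - t)).comp t (hd t)) using 1
    ring
  · rcases h.rest_or h' hS t with h1 | h1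
    · simpa [h1] using h'.mul_eq_abs (sub_nonneg.2 ht.2)
    · simpa [h1] using h.mul_eq_abs ht.1
  · rw [H.2.1.trans hc.2.1.symm]; simp
  · rw [H.2.2.trans hc.2.2.symm]; simp

lemma IsExtremal.isFiniteOptimal_concat (h : IsExtremal a b T x y u p q)
    (h' : IsExtremal a' (-b') T' x' y' u' p' q') (hS : T + T' ≤ S) :
    IsFiniteOptimal S a b a' b' (fun t => x t + x' (S - t)) (fun t => y t - y' (S - t))
      (fun t => u t + u' (S - t)) := by
  refine ⟨h.isFiniteTrajectory_concat h' hS, fun X Y U H => ?_⟩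
  have h1 := h.integral_concat_add_le h' hS H
  have h2 : 0 ≤ ∫ t in (0 : ℝ)..S, (X t - (x t + x' (S - t))) ^ 2 :=
    intervalIntegral.integral_nonneg (by linarith [h.nonneg, h'.nonneg]) fun t _ => sq_nonneg _
  linarith

/-- Uniqueness: a trajectory of cost at most `JF a b + JF a' (-b')` is the concatenation. -/
lemma IsExtremal.eqOn_concat (h : IsExtremal a b T x y u p q)
    (h' : IsExtremal a' (-b') T' x' y' u' p' q') (hS : T + T' ≤ S) {X Y U : ℝ → ℝ}
    (H : IsFiniteTrajectory S a b a' b' X Y U)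
    (hle : (1 / 2) * ∫ t in (0 : ℝ)..S, X t ^ 2 ≤ JF a b + JF a' (-b')) :
    EqOn X (fun t => x t + x' (S - t)) (Icc 0 S) ∧
    EqOn Y (fun t => y t - y' (S - t)) (Icc 0 S) := by
  have hS0 : 0 ≤ S := by linarith [h.nonneg, h'.nonneg]
  have hc := (h.isFiniteTrajectory_concat h' hS).1
  have h1 := h.integral_concat_add_le h' hS H
  have h2 := h.integral_concat h' hS
  have hX : EqOn X (fun t => x t + x' (S - t)) (Icc 0 S) := by
    -- For `S = 0` the integrals carry no information, and the endpoint condition decides.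
    rcases hS0.eq_or_lt with h0 | hpos
    · subst h0
      intro t ht
      rw [Icc_self, mem_singleton_iff] at ht
      subst ht
      exact H.2.1.trans (h.isFiniteTrajectory_concat h' hS).2.1.symm
    · exact eqOn_of_integral_sq_sub_nonpos hpos (H.1.continuousOn_x hS0) (hc.continuousOn_x hS0)
        (by linarith)
  exact ⟨hX, H.1.eqOn_y hc hS0 hX⟩

end Finite

/-! ### Absolutely continuous curves and their length -/

lemma absolutelyContinuousOnInterval_of_dist_le {E F : Type*} [PseudoMetricSpace E]
    [PseudoMetricSpace F] {f : ℝ → E} {g : ℝ → F} {a b C : ℝ}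
    (hf : AbsolutelyContinuousOnInterval f a b)
    (h : ∀ s ∈ uIcc a b, ∀ t ∈ uIcc a b, dist (g s) (g t) ≤ C * dist (f s) (f t)) :
    AbsolutelyContinuousOnInterval g a b := by
  have h0 : Tendsto (fun E : ℕ × (ℕ → ℝ × ℝ) =>
      C * ∑ i ∈ Finset.range E.1, dist (f (E.2 i).1) (f (E.2 i).2))
      (AbsolutelyContinuousOnInterval.totalLengthFilter ⊓
        𝓟 (AbsolutelyContinuousOnInterval.disjWithin a b)) (𝓝 0) := by
    simpa using Tendsto.const_mul C hf
  refine squeeze_zero' (Eventually.of_forall fun E => Finset.sum_nonneg fun i _ => dist_nonneg)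
    ?_ h0
  filter_upwards [mem_inf_of_right (mem_principal_self _)] with E hE
  rw [Finset.mul_sum]
  exact Finset.sum_le_sum fun i hi => h _ (hE.1 i hi).1 _ (hE.1 i hi).2

lemma absolutelyContinuousOnInterval_apply {q : ℝ → Fin 4 → ℝ} {a b : ℝ}
    (hq : AbsolutelyContinuousOnInterval q a b) (i : Fin 4) :
    AbsolutelyContinuousOnInterval (fun t => q t i) a b :=
  absolutelyContinuousOnInterval_of_dist_le (C := 1) hq fun s _ t _ => by
    rw [one_mul]; exact dist_le_pi_dist _ _ i

lemma ae_deriv_apply {q : ℝ → Fin 4 → ℝ} {a b : ℝ}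
    (hq : AbsolutelyContinuousOnInterval q a b) :
    ∀ᵐ t, t ∈ uIcc a b → ∀ i, deriv q t i = deriv (fun s => q s i) t := by
  have h : ∀ᵐ t, ∀ i, t ∈ uIcc a b → DifferentiableAt ℝ (fun s => q s i) t :=
    ae_all_iff.2 fun i => (absolutelyContinuousOnInterval_apply hq i).ae_differentiableAt
  filter_upwards [h] with t ht htm i
  rw [deriv_pi fun i => ht i htm]

lemma intervalIntegrable_finslerNorm {q : ℝ → Fin 4 → ℝ} {a b : ℝ}
    (hq : AbsolutelyContinuousOnInterval q a b) :
    IntervalIntegrable (fun t => finslerNorm (q t) (deriv q t)) volume a b := by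
  have hac := absolutelyContinuousOnInterval_apply hq
  have hd (i : Fin 4) := (hac i).intervalIntegrable_deriv
  have hc (i : Fin 4) := (hac i).continuousOn
  have h1 : IntervalIntegrable (fun t => max |deriv (fun s => q s 1) t| |deriv (fun s => q s 3) t|)
      volume a b := by
    have h1 := (hd 1).abs
    have h3 := (hd 3).abs
    exact ⟨h1.1.sup h3.1, h1.2.sup h3.2⟩
  have h2 := ((hd 0).sub ((hd 3).continuousOn_mul (hc 1))).abs
  have h3 := ((hd 2).sub ((hd 3).continuousOn_mul (((hc 0).pow 2).div_const 2))).abs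
  refine ((h1.add h2).add h3).congr_ae ?_
  rw [EventuallyEq, ae_restrict_iff' measurableSet_uIoc]
  filter_upwards [ae_deriv_apply hq] with t ht htm
  have := ht (uIoc_subset_uIcc htm)
  simp [finslerNorm, this]

/-- The calibration: integrated along a curve, it bounds the length below by the increment of `w`.
-/
lemma le_finslerNorm (q ξ : Fin 4 → ℝ) : ξ 3 ≤ finslerNorm q ξ := by
  have h1 := le_max_right |ξ 1| |ξ 3|
  have h2 := le_abs_self (ξ 3)
  have h3 := abs_nonneg (ξ 0 - q 1 * ξ 3)
  have h4 := abs_nonneg (ξ 2 - (q 0) ^ 2 / 2 * ξ 3)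
  unfold finslerNorm
  linarith

lemma eq_of_finslerNorm_eq {q ξ : Fin 4 → ℝ} (h : finslerNorm q ξ = ξ 3) :
    |ξ 1| ≤ ξ 3 ∧ ξ 0 = q 1 * ξ 3 ∧ ξ 2 = (q 0) ^ 2 / 2 * ξ 3 := by
  have h0 := le_max_left |ξ 1| |ξ 3|
  have h1 := le_max_right |ξ 1| |ξ 3|
  have h2 := le_abs_self (ξ 3)
  have h3 := abs_nonneg (ξ 0 - q 1 * ξ 3)
  have h4 := abs_nonneg (ξ 2 - (q 0) ^ 2 / 2 * ξ 3)
  unfold finslerNorm at h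
  refine ⟨by linarith, sub_eq_zero.1 (abs_eq_zero.1 (by linarith)),
    sub_eq_zero.1 (abs_eq_zero.1 (by linarith))⟩

section Curve

variable {p p' : Fin 4 → ℝ} {a b : ℝ} {q : ℝ → Fin 4 → ℝ}

lemma IsCurve.integral_deriv_eq (h : IsCurve p p' a b q) :
    ∫ t in a..b, deriv (fun s => q s 3) t = p' 3 - p 3 := by
  rw [(absolutelyContinuousOnInterval_apply h.2.1 3).integral_deriv_eq_sub, h.2.2.1, h.2.2.2]

lemma IsCurve.ae_deriv_le (h : IsCurve p p' a b q) :
    ∀ᵐ t, t ∈ Icc a b → deriv (fun s => q s 3) t ≤ finslerNorm (q t) (deriv q t) := by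
  filter_upwards [ae_deriv_apply h.2.1] with t ht htm
  rw [uIcc_of_le h.1] at ht
  rw [← ht htm 3]
  exact le_finslerNorm _ _

lemma IsCurve.le_finslerLength (h : IsCurve p p' a b q) : p' 3 - p 3 ≤ finslerLength a b q := by
  rw [← h.integral_deriv_eq]
  exact intervalIntegral.integral_mono_ae_restrict h.1
    (absolutelyContinuousOnInterval_apply h.2.1 3).intervalIntegrable_deriv
    (intervalIntegrable_finslerNorm h.2.1) ((ae_restrict_iff' measurableSet_Icc).2 h.ae_deriv_le)

lemma IsCurve.ae_finslerNorm_eq (h : IsCurve p p' a b q)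
    (hle : finslerLength a b q ≤ p' 3 - p 3) :
    ∀ᵐ t, t ∈ Icc a b → finslerNorm (q t) (deriv q t) = deriv (fun s => q s 3) t := by
  have i1 := (absolutelyContinuousOnInterval_apply h.2.1 3).intervalIntegrable_deriv
  have i2 := intervalIntegrable_finslerNorm h.2.1
  have h0 : ∫ t in a..b, (finslerNorm (q t) (deriv q t) - deriv (fun s => q s 3) t) = 0 := by
    rw [intervalIntegral.integral_sub i2 i1, h.integral_deriv_eq]
    have := h.le_finslerLength
    unfold finslerLength at hle this
    linarith
  rw [intervalIntegral.integral_eq_zero_iff_of_le_of_nonneg_ae h.1 ?_ (i2.sub i1)] at h0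
  · rw [EventuallyEq, ae_restrict_iff' measurableSet_Ioc] at h0
    filter_upwards [h0, ae_mem_Ioo_of_mem_Icc a b] with t ht h1 htm
    exact sub_eq_zero.1 (ht (Ioo_subset_Ioc_self (h1 htm)))
  · rw [EventuallyLE, ae_restrict_iff' measurableSet_Ioc]
    filter_upwards [h.ae_deriv_le] with t ht htm
    exact sub_nonneg.2 (ht (Ioc_subset_Icc_self htm))

/-- Change of variables along an absolutely continuous function. -/
lemma eqOn_comp_of_ae_deriv_eq {F f φ v : ℝ → ℝ} (hab : a ≤ b) (hF : ∀ s, HasDerivAt F (f s) s)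
    (hf : Continuous f) (hφ : AbsolutelyContinuousOnInterval φ a b)
    (hv : AbsolutelyContinuousOnInterval v a b)
    (h : ∀ᵐ t, t ∈ Icc a b → deriv v t = f (φ t) * deriv φ t) (h0 : v a = F (φ a)) :
    ∀ t ∈ Icc a b, v t = F (φ t) := by
  have hFφ : AbsolutelyContinuousOnInterval (fun t => F (φ t)) a b := by
    obtain ⟨C, hC⟩ := hφ.exists_bound
    obtain ⟨D, hD⟩ := isCompact_Icc.exists_bound_of_continuousOn (hf.continuousOn (s := Icc (-C) C))
    exact absolutelyContinuousOnInterval_of_dist_le hφ fun s hs t ht =>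
      abs_sub_le_of_hasDerivAt hF hD _ (abs_le.1 (hC s hs)) _ (abs_le.1 (hC t ht))
  have hd : ∀ᵐ t, t ∈ uIcc a b → HasDerivAt (fun t => v t - F (φ t)) 0 t := by
    filter_upwards [hφ.ae_differentiableAt, hv.ae_differentiableAt, h] with t h1 h2 h3 ht
    convert! (h2 ht).hasDerivAt.sub ((hF (φ t)).comp t (h1 ht).hasDerivAt) using 1
    rw [h3 (by rwa [uIcc_of_le hab] at ht), sub_self]
  obtain ⟨c, hc⟩ := (hv.fun_sub hFφ).const_of_ae_hasDerivAt_zero hd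
  rw [uIcc_of_le hab] at hc
  intro t ht
  have h1 := hc t ht
  rw [← hc a ⟨le_rfl, hab⟩, h0, sub_self] at h1
  exact sub_eq_zero.1 h1

lemma abs_sub_le_of_ae_abs_deriv_le {φ v : ℝ → ℝ} (hφ : AbsolutelyContinuousOnInterval φ a b)
    (hv : AbsolutelyContinuousOnInterval v a b)
    (h : ∀ᵐ t, t ∈ Icc a b → |deriv v t| ≤ deriv φ t) {s t : ℝ} (hs : s ∈ Icc a b)
    (ht : t ∈ Icc a b) (hst : s ≤ t) : |v t - v s| ≤ φ t - φ s := by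
  have hsub : uIcc s t ⊆ uIcc a b := by
    rw [uIcc_of_le hst, uIcc_of_le (hs.1.trans hs.2)]; exact Icc_subset_Icc hs.1 ht.2
  rw [← (hφ.mono hsub).integral_deriv_eq_sub, ← (hv.mono hsub).integral_deriv_eq_sub]
  refine (intervalIntegral.abs_integral_le_integral_abs hst).trans ?_
  refine intervalIntegral.integral_mono_ae_restrict hst (hv.mono hsub).intervalIntegrable_deriv.abs
    (hφ.mono hsub).intervalIntegrable_deriv ((ae_restrict_iff' measurableSet_Icc).2 ?_)
  filter_upwards [h] with r hr hrm
  exact hr ⟨hs.1.trans hrm.1, hrm.2.trans ht.2⟩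

/-- A curve whose length is the increment of the last coordinate is, up to reparametrization, the
lift of an admissible trajectory. -/
lemma IsCurve.exists_trajectory (h : IsCurve p p' a b q)
    (hle : finslerLength a b q ≤ p' 3 - p 3) :
    MonotoneOn (fun t => q t 3 - p 3) (Icc a b) ∧ ContinuousOn (fun t => q t 3 - p 3) (Icc a b) ∧
    ∃ x y u : ℝ → ℝ, IsTrajectory (Icc 0 (p' 3 - p 3)) (p 0) (p 1) x y u ∧
      ∀ t ∈ Icc a b, q t = lift (p 2) (p 3) x y (q t 3 - p 3) := by
  obtain ⟨hab, hq, hqa, hqb⟩ := h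
  set S := p' 3 - p 3 with hS
  set φ : ℝ → ℝ := fun t => q t 3 - p 3 with hφdef
  have hac := absolutelyContinuousOnInterval_apply hq
  have hφ : AbsolutelyContinuousOnInterval φ a b :=
    absolutelyContinuousOnInterval_of_dist_le (C := 1) (hac 3) fun s _ t _ => by simp [φ]
  have hφ' (t : ℝ) : deriv φ t = deriv (fun s => q s 3) t := deriv_sub_const _
  have hrel : ∀ᵐ t, t ∈ Icc a b → |deriv (fun s => q s 1) t| ≤ deriv φ t ∧
      deriv (fun s => q s 0) t = q t 1 * deriv φ t ∧
      deriv (fun s => q s 2) t = (q t 0) ^ 2 / 2 * deriv φ t := by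
    filter_upwards [IsCurve.ae_finslerNorm_eq ⟨hab, hq, hqa, hqb⟩ hle, ae_deriv_apply hq]
      with t h1 h2 ht
    rw [uIcc_of_le hab] at h2
    rw [← h2 ht] at h1
    have := eq_of_finslerNorm_eq (h1 ht)
    rw [hφ', ← h2 ht, ← h2 ht, ← h2 ht, ← h2 ht]
    exact this
  -- This single estimate makes `φ` monotone and makes `y` a 1-Lipschitz function of `φ`, well
  -- defined even where `φ` is constant.
  have hy {s t : ℝ} (hs : s ∈ Icc a b) (ht : t ∈ Icc a b) (hst : s ≤ t) :
      |q t 1 - q s 1| ≤ φ t - φ s :=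
    abs_sub_le_of_ae_abs_deriv_le hφ (hac 1) (hrel.mono fun t ht htm => (ht htm).1) hs ht hst
  have hmono : MonotoneOn φ (Icc a b) := fun s hs t ht hst =>
    sub_nonneg.1 ((abs_nonneg _).trans (hy hs ht hst))
  have hy' {s t : ℝ} (hs : s ∈ Icc a b) (ht : t ∈ Icc a b) : |q t 1 - q s 1| ≤ |φ t - φ s| := by
    rcases le_total s t with hst | hst
    · exact (hy hs ht hst).trans (le_abs_self _)
    · rw [abs_sub_comm, abs_sub_comm (φ t)]
      exact (hy ht hs hst).trans (le_abs_self _)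
  have hcont : ContinuousOn φ (Icc a b) := by simpa [uIcc_of_le hab] using hφ.continuousOn
  have hφa : φ a = 0 := by simp [φ, hqa]
  have hφb : φ b = S := by simp [φ, hqb, hS]
  have ha : a ∈ Icc a b := ⟨le_rfl, hab⟩
  have hb : b ∈ Icc a b := ⟨hab, le_rfl⟩
  have hS0 : 0 ≤ S := by rw [← hφa, ← hφb]; exact hmono ha hb hab
  have hφmem {t : ℝ} (ht : t ∈ Icc a b) : φ t ∈ Icc 0 S := by
    rw [← hφa, ← hφb]; exact ⟨hmono ha ht ht.1, hmono ht hb ht.2⟩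
  -- Clamping `s` to `[0, S]` gives a right inverse `g` of `φ` on `[0, S]` that is defined on all of
  -- `ℝ`, so `y` below is globally 1-Lipschitz; `g` itself need not be continuous.
  have hsurj (s : ℝ) : ∃ t ∈ Icc a b, φ t = max 0 (min s S) := by
    refine intermediate_value_Icc hab hcont ?_
    rw [hφa, hφb]
    exact ⟨le_max_left _ _, max_le hS0 (min_le_right _ _)⟩
  choose g hg hφg using hsurj
  set y : ℝ → ℝ := fun s => q (g s) 1 with hydef
  have hylip : LipschitzWith 1 y := by
    refine LipschitzWith.of_dist_le_mul fun s t => ?_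
    rw [Real.dist_eq, Real.dist_eq, NNReal.coe_one, one_mul]
    refine (hy' (hg t) (hg s)).trans ?_
    rw [hφg, hφg]
    refine (abs_max_sub_max_le_max _ _ _ _).trans ?_
    rw [sub_self, abs_zero]
    refine max_le (abs_nonneg _) ((abs_min_sub_min_le_max _ _ _ _).trans ?_)
    rw [sub_self, abs_zero]
    exact max_le le_rfl (abs_nonneg _)
  have hqy {t : ℝ} (ht : t ∈ Icc a b) : q t 1 = y (φ t) := by
    have h1 := hy' (hg (φ t)) ht
    rw [hφg, min_eq_left (hφmem ht).2, max_eq_right (hφmem ht).1, sub_self, abs_zero] at h1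
    exact sub_eq_zero.1 (abs_eq_zero.1 (le_antisymm h1 (abs_nonneg _)))
  have hy0 : y 0 = p 1 := by rw [← hφa, ← hqy ha, hqa]
  -- Only `y` is obtained through `g`. The functions of `w` for `x` and `z` are defined as
  -- primitives and matched with the curve by the chain rule.
  set x : ℝ → ℝ := fun s => p 0 + prim y s with hxdef
  have hx (s : ℝ) : HasDerivAt x (y s) s := (hasDerivAt_prim hylip.continuous s).const_add _
  have hxc : Continuous x := continuous_iff_continuousAt.2 fun s => (hx s).continuousAt
  have hqx := eqOn_comp_of_ae_deriv_eq hab hx hylip.continuous hφ (hac 0)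
    (hrel.mono fun t ht htm => by rw [(ht htm).2.1, hqy htm]) (by simp [hφa, x, prim, hqa])
  have hz (s : ℝ) : HasDerivAt (fun s => p 2 + (1 / 2) * prim (fun r => x r ^ 2) s)
      (1 / 2 * x s ^ 2) s := ((hasDerivAt_prim (hxc.pow 2) s).const_mul _).const_add _
  have hqz := eqOn_comp_of_ae_deriv_eq hab hz (by fun_prop) hφ (hac 2)
    (hrel.mono fun t ht htm => by rw [(ht htm).2.2, hqx t htm]; ring)
    (by simp [hφa, prim, hqa])
  refine ⟨hmono, hcont, x, y, deriv y, ⟨(measurable_deriv y).aemeasurable,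
    Eventually.of_forall fun t => by simpa using norm_deriv_le_of_lipschitz hylip (x₀ := t),
    fun t _ => ?_, fun t _ => rfl⟩, fun t ht => ?_⟩
  · rw [(hylip.lipschitzOnWith (s := uIcc 0 t)).absolutelyContinuousOnInterval.integral_deriv_eq_sub,
      hy0]
    ring
  · ext i
    fin_cases i
    · exact hqx t ht
    · exact hqy ht
    · exact hqz t ht
    · simp [lift]

end Curve

/-! ### Lifted trajectories -/

section Lift

variable {S x₀ y₀ z₀ w₀ : ℝ} {x y u : ℝ → ℝ}

lemma finslerNorm_f1_add_f2 (q : Fin 4 → ℝ) {c : ℝ} (hc : |c| ≤ 1) :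
    finslerNorm q (f1 q + c • f2 q) = 1 := by
  simp [finslerNorm, f1, f2, hc]

lemma IsTrajectory.ae_hasDerivAt_lift (h : IsTrajectory (Icc 0 S) x₀ y₀ x y u) (hS : 0 ≤ S) :
    ∀ᵐ t, t ∈ Icc 0 S → HasDerivAt (lift z₀ w₀ x y)
      (f1 (lift z₀ w₀ x y t) + u t • f2 (lift z₀ w₀ x y t)) t := by
  filter_upwards [h.ae_hasDerivAt_y hS, ae_mem_Ioo_of_mem_Icc 0 S] with t h1 h2 ht
  have ht' := h2 ht
  have hc := (h.continuousOn_x hS).pow 2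
  have hz : HasDerivAt (fun t => z₀ + (1 / 2) * ∫ s in (0 : ℝ)..t, x s ^ 2) (1 / 2 * x t ^ 2) t := by
    refine HasDerivAt.const_add z₀ (HasDerivAt.const_mul _
      (intervalIntegral.integral_hasDerivAt_right
      ((hc.mono (Icc_subset_Icc_right ht.2)).intervalIntegrable_of_Icc ht.1) ?_
      (hc.continuousAt (Icc_mem_nhds ht'.1 ht'.2))))
    exact (hc.mono Ioo_subset_Icc_self).stronglyMeasurableAtFilter isOpen_Ioo t ht'
  rw [hasDerivAt_pi]
  intro i
  fin_cases i
  · simpa [lift, f1, f2] using h.hasDerivAt_x ht'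
  · simpa [lift, f1, f2] using h1 ht'
  · convert! hz using 1
    simp [lift, f1, f2]; ring
  · simpa [lift, f1, f2] using (hasDerivAt_id t).const_add w₀

lemma IsTrajectory.ae_finslerNorm_lift (h : IsTrajectory (Icc 0 S) x₀ y₀ x y u) (hS : 0 ≤ S) :
    ∀ᵐ t, t ∈ Icc 0 S →
      finslerNorm (lift z₀ w₀ x y t) (deriv (lift z₀ w₀ x y) t) = 1 := by
  filter_upwards [h.ae_hasDerivAt_lift hS, (ae_restrict_iff' measurableSet_Icc).1 h.abs_le_one]
    with t h1 h2 ht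
  rw [(h1 ht).deriv]
  exact finslerNorm_f1_add_f2 _ (h2 ht)

lemma IsTrajectory.absolutelyContinuous_lift (h : IsTrajectory (Icc 0 S) x₀ y₀ x y u)
    (hS : 0 ≤ S) : AbsolutelyContinuousOnInterval (lift z₀ w₀ x y) 0 S := by
  have hc : ContinuousOn (fun t => x t ^ 2) (Icc 0 S) := (h.continuousOn_x hS).pow 2
  obtain ⟨C, hC⟩ := h.exists_abs_sub_le_x hS
  obtain ⟨D, hD⟩ := isCompact_Icc.exists_bound_of_continuousOn hc
  have hz := abs_sub_le_of_eq_integral (c := 0) (hc.intervalIntegrable_of_Icc hS)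
    (Eventually.of_forall hD) (g := fun t => ∫ s in (0 : ℝ)..t, x s ^ 2) (fun t _ => by simp)
  refine LipschitzOnWith.absolutelyContinuousOnInterval (K := (1 + |C| + |D|).toNNReal) ?_
  rw [uIcc_of_le hS]
  refine LipschitzOnWith.of_dist_le_mul fun s hs t ht => ?_
  rw [Real.coe_toNNReal _ (by positivity), dist_pi_le_iff (by positivity)]
  have key : ∀ {A K : ℝ}, A ≤ K * |s - t| → K ≤ 1 + |C| + |D| →
      A ≤ (1 + |C| + |D|) * dist s t := fun h1 h2 =>
    h1.trans (mul_le_mul_of_nonneg_right h2 (abs_nonneg _))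
  intro i
  fin_cases i
  · exact key (hC s hs t ht) (by linarith [le_abs_self C, abs_nonneg D])
  · exact key (h.abs_sub_le_y hS s hs t ht) (by linarith [abs_nonneg C, abs_nonneg D])
  · refine key (K := D) ?_ (by linarith [le_abs_self D, abs_nonneg C])
    have := hz s hs t ht
    simp only [lift, Real.dist_eq]
    simp only [Fin.reduceFinMk, Matrix.cons_val, add_sub_add_left_eq_sub, ← mul_sub, abs_mul]
    have h0 := abs_nonneg ((∫ s in (0 : ℝ)..s, x s ^ 2) - ∫ s in (0 : ℝ)..t, x s ^ 2)
    rw [abs_of_nonneg (by norm_num : (0 : ℝ) ≤ 1 / 2)]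
    linarith
  · refine key (K := 1) ?_ (by linarith [abs_nonneg C, abs_nonneg D])
    simp [lift, Real.dist_eq]

lemma IsTrajectory.finslerLength_lift (h : IsTrajectory (Icc 0 S) x₀ y₀ x y u) (hS : 0 ≤ S) :
    finslerLength 0 S (lift z₀ w₀ x y) = S := by
  rw [finslerLength, intervalIntegral.integral_congr_ae (g := fun _ => 1)]
  · simp
  · filter_upwards [h.ae_finslerNorm_lift hS] with t ht htm
    rw [uIoc_of_le hS] at htm
    exact ht (Ioc_subset_Icc_self htm)

end Lift

/-! ### The unit balls -/

lemma linearIndependent_vertex (q : Fin 4 → ℝ) : LinearIndependent ℝ (vertex q) := by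
  rw [Fintype.linearIndependent_iff]
  intro g hg
  have h0 := congrFun hg 0
  have h1 := congrFun hg 1
  have h2 := congrFun hg 2
  have h3 := congrFun hg 3
  simp [Fin.sum_univ_four, vertex, f1, f2, f3, f6] at h0 h1 h2 h3
  have g0 : g 0 = 0 := by linarith
  have g1 : g 1 = 0 := by linarith
  rw [g0, g1] at h0 h2
  intro i
  fin_cases i
  · exact g0
  · exact g1
  · show g 2 = 0
    linarith
  · show g 3 = 0
    linarith

lemma convexOn_finslerNorm (q : Fin 4 → ℝ) : ConvexOn ℝ univ (finslerNorm q) := by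
  have habs (L : (Fin 4 → ℝ) →ₗ[ℝ] ℝ) : ConvexOn ℝ univ fun ξ => |L ξ| :=
    (convexOn_univ_norm (E := ℝ)).comp_linearMap L
  let e (i : Fin 4) : (Fin 4 → ℝ) →ₗ[ℝ] ℝ := LinearMap.proj i
  exact (((habs (e 1)).sup (habs (e 3))).add (habs (e 0 - q 1 • e 3))).add
    (habs (e 2 - ((q 0) ^ 2 / 2) • e 3))

/-- The cross-polytope spanned by a finite family and its opposite contains the combinations whose
coefficients have absolute sum at most one. -/
lemma sum_smul_mem_convexHull {ι E : Type*} [Fintype ι] [Nonempty ι] [AddCommGroup E] [Module ℝ E]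
    (v : ι → E) (c : ι → ℝ) (hc : ∑ i, |c i| ≤ 1) :
    ∑ i, c i • v i ∈ convexHull ℝ (range v ∪ range (-v)) := by
  -- The missing mass is spread evenly over all vertices, where it cancels in opposite pairs.
  set δ : ℝ := (1 - ∑ i, |c i|) / (2 * Fintype.card ι) with hδ
  have hcard : (0 : ℝ) < Fintype.card ι := by exact_mod_cast Fintype.card_pos
  have hδ0 : 0 ≤ δ := div_nonneg (by linarith) (by positivity)
  let w : ι ⊕ ι → ℝ := Sum.elim (fun i => (|c i| + c i) / 2 + δ) fun i => (|c i| - c i) / 2 + δ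
  let V : ι ⊕ ι → E := Sum.elim v (-v)
  have hsum : ∑ k, w k • V k = ∑ i, c i • v i := by
    simp only [Fintype.sum_sum_type, w, V, Sum.elim_inl, Sum.elim_inr, ← Finset.sum_add_distrib]
    refine Finset.sum_congr rfl fun i _ => ?_
    rw [Pi.neg_apply, smul_neg, ← sub_eq_add_neg, ← sub_smul]
    congr 1
    ring
  rw [← hsum]
  refine (convex_convexHull ℝ _).sum_mem (fun k _ => ?_) ?_ fun k _ => subset_convexHull ℝ _ ?_
  · rcases k with i | i
    · have := neg_abs_le (c i)
      simp only [w, Sum.elim_inl]; linarith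
    · have := le_abs_self (c i)
      simp only [w, Sum.elim_inr]; linarith
  · simp only [Fintype.sum_sum_type, w, Sum.elim_inl, Sum.elim_inr, ← Finset.sum_add_distrib]
    rw [Finset.sum_congr rfl fun i _ => show (|c i| + c i) / 2 + δ + ((|c i| - c i) / 2 + δ)
      = |c i| + 2 * δ by ring, Finset.sum_add_distrib, Finset.sum_const, Finset.card_univ,
      nsmul_eq_mul, hδ]
    field_simp
    ring
  · rcases k with i | i
    · exact Or.inl ⟨i, rfl⟩
    · exact Or.inr ⟨i, rfl⟩

lemma abs_add_abs_eq_max (s t : ℝ) : |(s + t) / 2| + |(s - t) / 2| = max |t| |s| := by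
  rcases le_total 0 s with hs | hs <;> rcases le_total 0 t with ht | ht <;>
  rcases le_total |s| |t| with h | h <;>
  simp only [abs_of_nonneg, abs_of_nonpos, hs, ht] at h <;>
  grind

/-- The norm is the `ℓ¹` norm of the coordinates in the basis `vertex q`; the first two coordinates
give the maximum, by `abs_add_abs_eq_max`. -/
lemma setOf_finslerNorm_le_one (q : Fin 4 → ℝ) :
    {ξ : Fin 4 → ℝ | finslerNorm q ξ ≤ 1} =
      convexHull ℝ (range (vertex q) ∪ range (-vertex q)) := by
  apply Subset.antisymm
  · intro ξ hξ
    let c : Fin 4 → ℝ := ![(ξ 3 + ξ 1) / 2, (ξ 3 - ξ 1) / 2, -(ξ 0 - q 1 * ξ 3),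
      ξ 2 - (q 0) ^ 2 / 2 * ξ 3]
    have hc : ∑ i, c i • vertex q i = ξ := by
      ext i
      fin_cases i <;> simp [Fin.sum_univ_four, c, vertex, f1, f2, f3, f6] <;> ring
    rw [← hc]
    refine sum_smul_mem_convexHull _ _ ?_
    refine le_trans (le_of_eq ?_) hξ
    have : ∑ i, |c i| = |(ξ 3 + ξ 1) / 2| + |(ξ 3 - ξ 1) / 2| + |-(ξ 0 - q 1 * ξ 3)|
        + |ξ 2 - (q 0) ^ 2 / 2 * ξ 3| := by simp only [Fin.sum_univ_four]; rfl
    rw [this, abs_add_abs_eq_max, abs_neg, finslerNorm]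
  · have hconv := (convexOn_finslerNorm q).convex_le 1
    simp only [mem_univ, true_and] at hconv
    refine convexHull_min ?_ hconv
    rintro _ (⟨i, rfl⟩ | ⟨i, rfl⟩) <;> fin_cases i <;>
      simp [finslerNorm, vertex, f1, f2, f3, f6]

/-! ### Shortest paths -/

section Shortest

variable {a b a' b' T T' S z₀ w₀ z₁ w₁ : ℝ} {x y u p q x' y' u' p' q' X Y U : ℝ → ℝ}

lemma IsExtremal.integral_sq_le_of_isFiniteOptimal (h : IsExtremal a b T x y u p q)
    (h' : IsExtremal a' (-b') T' x' y' u' p' q') (hS : T + T' ≤ S)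
    (H : IsFiniteOptimal S a b a' b' X Y U) :
    (1 / 2) * ∫ t in (0 : ℝ)..S, X t ^ 2 ≤ JF a b + JF a' (-b') :=
  (H.2 _ _ _ (h.isFiniteTrajectory_concat h' hS)).trans_eq (h.integral_concat h' hS)

/-- A curve of minimal length is a monotone reparametrization of the lifted concatenation. -/
lemma IsExtremal.isCurve_eq_lift (h : IsExtremal a b T x y u p q)
    (h' : IsExtremal a' (-b') T' x' y' u' p' q') (hS : T + T' ≤ w₁ - w₀)
    (hz : z₁ - z₀ = JF a b + JF a' (-b')) (H : IsFiniteOptimal (w₁ - w₀) a b a' b' X Y U)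
    {c d : ℝ} {γ : ℝ → Fin 4 → ℝ} (hγ : IsCurve ![a, b, z₀, w₀] ![a', b', z₁, w₁] c d γ)
    (hle : finslerLength c d γ ≤ w₁ - w₀) :
    MonotoneOn (fun t => γ t 3 - w₀) (Icc c d) ∧ ContinuousOn (fun t => γ t 3 - w₀) (Icc c d) ∧
      ∀ t ∈ Icc c d, γ t = lift z₀ w₀ X Y (γ t 3 - w₀) := by
  obtain ⟨hmono, hcont, X', Y', U', hX', hlift⟩ := hγ.exists_trajectory hle
  simp only [Matrix.cons_val] at hmono hcont hX' hlift
  refine ⟨hmono, hcont, ?_⟩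
  have hcm : c ∈ Icc c d := ⟨le_rfl, hγ.1⟩
  have hdm : d ∈ Icc c d := ⟨hγ.1, le_rfl⟩
  have hγc : γ c 3 - w₀ = 0 := by rw [hγ.2.2.1]; simp
  have hγd : γ d 3 - w₀ = w₁ - w₀ := by rw [hγ.2.2.2]; simp
  have hend := hlift d hdm
  rw [hγd, hγ.2.2.2] at hend
  have e0 := congrFun hend 0
  have e1 := congrFun hend 1
  have e2 := congrFun hend 2
  simp only [lift, Matrix.cons_val] at e0 e1 e2
  -- The `z` coordinate of the endpoint, `e2`, says that the cost of `X'` is `z₁ - z₀`, the minimal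
  -- value by `hz`.
  have heq' := h.eqOn_concat h' hS ⟨hX', e0.symm, e1.symm⟩ (by linarith)
  have heq := h.eqOn_concat h' hS H.1 (h.integral_sq_le_of_isFiniteOptimal h' hS H)
  have hXX : EqOn X' X (Icc 0 (w₁ - w₀)) := heq'.1.trans heq.1.symm
  have hYY : EqOn Y' Y (Icc 0 (w₁ - w₀)) := heq'.2.trans heq.2.symm
  intro t ht
  have hmem : γ t 3 - w₀ ∈ Icc 0 (w₁ - w₀) := by
    rw [← hγc, ← hγd]
    exact ⟨by simpa using hmono hcm ht ht.1, by simpa using hmono ht hdm ht.2⟩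
  refine (hlift t ht).trans ?_
  have hint : ∫ s in (0 : ℝ)..(γ t 3 - w₀), X' s ^ 2 = ∫ s in (0 : ℝ)..(γ t 3 - w₀), X s ^ 2 := by
    refine intervalIntegral.integral_congr fun s hs => ?_
    rw [uIcc_of_le hmem.1] at hs
    simp only [hXX ⟨hs.1, hs.2.trans hmem.2⟩]
  simp only [lift, hXX hmem, hYY hmem, hint]

lemma IsExtremal.isCurve_lift (h : IsExtremal a b T x y u p q)
    (h' : IsExtremal a' (-b') T' x' y' u' p' q') (hS : T + T' ≤ w₁ - w₀)
    (hz : z₁ - z₀ = JF a b + JF a' (-b')) (H : IsFiniteOptimal (w₁ - w₀) a b a' b' X Y U) :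
    IsCurve ![a, b, z₀, w₀] ![a', b', z₁, w₁] 0 (w₁ - w₀) (lift z₀ w₀ X Y) := by
  have hS0 : 0 ≤ w₁ - w₀ := by linarith [h.nonneg, h'.nonneg]
  have hc := h.isFiniteOptimal_concat h' hS
  have hcost : (1 / 2) * ∫ t in (0 : ℝ)..(w₁ - w₀), X t ^ 2 = JF a b + JF a' (-b') :=
    le_antisymm (h.integral_sq_le_of_isFiniteOptimal h' hS H)
      ((h.integral_concat h' hS).symm.trans_le (hc.2 _ _ _ H.1))
  refine ⟨hS0, H.1.1.absolutelyContinuous_lift hS0, ?_, ?_⟩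
  · simp [lift, H.1.1.x_eq 0 ⟨le_rfl, hS0⟩, H.1.1.y_eq 0 ⟨le_rfl, hS0⟩]
  · rw [lift, H.1.2.1, H.1.2.2, hcost, ← hz]
    simp

lemma IsExtremal.chattersBefore (h : IsExtremal a b T x y u p q)
    (h' : IsExtremal a' (-b') T' x' y' u' p' q') (hS : T + T' ≤ S) (hab : (a, b) ≠ (0, 0))
    (hU : ∀ᵐ t, t ∈ Icc 0 S → U t = u t + u' (S - t)) : ChattersBefore U T := by
  obtain ⟨s, σ, hs0, hs, hlim, hσ, hu⟩ := h.chatter hab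
  refine ⟨s, σ, hs0, hs, hlim, hσ, fun k => ?_⟩
  rw [ae_restrict_iff' measurableSet_Ioo]
  filter_upwards [hU] with t ht htm
  have h1 : t < T := htm.2.trans_le (hs.monotone.ge_of_tendsto hlim _)
  have h2 : 0 ≤ t := by rw [← hs0]; exact (hs.monotone (Nat.zero_le k)).trans htm.1.le
  rw [ht ⟨h2, by linarith [h'.nonneg]⟩, hu k t htm, (h'.rest (S - t) (by linarith)).2.2.1,
    add_zero]

lemma IsExtremal.chattersAfter (h : IsExtremal a b T x y u p q)
    (h' : IsExtremal a' (-b') T' x' y' u' p' q') (hS : T + T' ≤ S) (hab : (a', b') ≠ (0, 0))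
    (hU : ∀ᵐ t, t ∈ Icc 0 S → U t = u t + u' (S - t)) : ChattersAfter U (S - T') S := by
  obtain ⟨s, σ, hs0, hs, hlim, hσ, hu⟩ := h'.chatter (fun h0 => hab (by
    simpa only [Prod.mk.injEq, neg_eq_zero] using h0))
  refine ⟨fun k => S - s k, σ, by simp [hs0], fun i j hij => sub_lt_sub_left (hs hij) S,
    hlim.const_sub S, hσ, fun k => ?_⟩
  rw [ae_restrict_iff' measurableSet_Ioo]
  filter_upwards [hU] with t ht htm
  have htm' : S - t ∈ Ioo (s k) (s (k + 1)) := ⟨by linarith [htm.2], by linarith [htm.1]⟩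
  have h1 : S - t < T' := htm'.2.trans_le (hs.monotone.ge_of_tendsto hlim _)
  have h2 : 0 ≤ S - t := by rw [← hs0]; exact (hs.monotone (Nat.zero_le k)).trans htm'.1.le
  rw [ht ⟨by linarith [h.nonneg], by linarith⟩, hu k _ htm', (h.rest t (by linarith)).2.2.1,
    zero_add]

end Shortest

end FullerFinsler

theorem mainTheorem4 :
    -- the unit balls are hyperoctahedra with the vertices `±(f1 + f2)`, `±(f1 - f2)`, `±f3`, `±f6`
    (∀ q : Fin 4 → ℝ,
      LinearIndependent ℝ (FullerFinsler.vertex q) ∧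
      {ξ : Fin 4 → ℝ | FullerFinsler.finslerNorm q ξ ≤ 1} =
        convexHull ℝ (Set.range (FullerFinsler.vertex q) ∪ Set.range (-FullerFinsler.vertex q))) ∧
    ∀ x₀ y₀ z₀ w₀ x₁ y₁ z₁ w₁ : ℝ,
      z₁ - z₀ = FullerFinsler.JF x₀ y₀ + FullerFinsler.JF x₁ (-y₁) →
      FullerFinsler.TF x₀ y₀ + FullerFinsler.TF x₁ (-y₁) ≤ w₁ - w₀ →
      -- an optimal trajectory of the finite-time Fuller problem exists
      (∃ xF yF uF : ℝ → ℝ, FullerFinsler.IsFiniteOptimal (w₁ - w₀) x₀ y₀ x₁ y₁ xF yF uF) ∧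
      ∀ xF yF uF : ℝ → ℝ, FullerFinsler.IsFiniteOptimal (w₁ - w₀) x₀ y₀ x₁ y₁ xF yF uF →
        -- the lifted curve is a shortest path, of length `w₁ - w₀`
        FullerFinsler.IsShortestPath ![x₀, y₀, z₀, w₀] ![x₁, y₁, z₁, w₁] 0 (w₁ - w₀)
          (FullerFinsler.lift z₀ w₀ xF yF) ∧
        FullerFinsler.finslerLength 0 (w₁ - w₀) (FullerFinsler.lift z₀ w₀ xF yF) = w₁ - w₀ ∧
        -- its velocity is `f1 + uF • f2`, of norm one
        (∀ᵐ t ∂(volume.restrict (Set.Icc 0 (w₁ - w₀))),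
          HasDerivAt (FullerFinsler.lift z₀ w₀ xF yF)
            (FullerFinsler.f1 (FullerFinsler.lift z₀ w₀ xF yF t) +
              uF t • FullerFinsler.f2 (FullerFinsler.lift z₀ w₀ xF yF t)) t ∧
          FullerFinsler.finslerNorm (FullerFinsler.lift z₀ w₀ xF yF t)
            (deriv (FullerFinsler.lift z₀ w₀ xF yF) t) = 1) ∧
        -- every shortest path is a monotone reparametrization of the lifted curve
        (∀ (a b : ℝ) (q : ℝ → Fin 4 → ℝ),
          FullerFinsler.IsShortestPath ![x₀, y₀, z₀, w₀] ![x₁, y₁, z₁, w₁] a b q →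
          ∃ φ : ℝ → ℝ, MonotoneOn φ (Set.Icc a b) ∧ ContinuousOn φ (Set.Icc a b) ∧
            φ a = 0 ∧ φ b = w₁ - w₀ ∧
            ∀ t ∈ Set.Icc a b, q t = FullerFinsler.lift z₀ w₀ xF yF (φ t)) ∧
        -- the lifted curve is the only solution of the time minimization problem
        (∀ (T : ℝ) (q : ℝ → Fin 4 → ℝ),
          FullerFinsler.IsCurve ![x₀, y₀, z₀, w₀] ![x₁, y₁, z₁, w₁] 0 T q →
          (∀ᵐ t ∂(volume.restrict (Set.Icc 0 T)),
            FullerFinsler.finslerNorm (q t) (deriv q t) ≤ 1) →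
          w₁ - w₀ ≤ T ∧
            (T = w₁ - w₀ →
              Set.EqOn q (FullerFinsler.lift z₀ w₀ xF yF) (Set.Icc 0 (w₁ - w₀)))) ∧
        -- chattering at both ends, and rest in between
        ((x₀, y₀) ≠ (0, 0) → FullerFinsler.ChattersBefore uF (FullerFinsler.TF x₀ y₀)) ∧
        ((x₁, y₁) ≠ (0, 0) →
          FullerFinsler.ChattersAfter uF (w₁ - w₀ - FullerFinsler.TF x₁ (-y₁)) (w₁ - w₀)) ∧
        (∀ t ∈ Set.Icc (FullerFinsler.TF x₀ y₀) (w₁ - w₀ - FullerFinsler.TF x₁ (-y₁)),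
          xF t = 0 ∧ yF t = 0) ∧
        (∀ᵐ t ∂(volume.restrict
            (Set.Icc (FullerFinsler.TF x₀ y₀) (w₁ - w₀ - FullerFinsler.TF x₁ (-y₁)))),
          uF t = 0) := by
  open FullerFinsler in
  refine ⟨fun q => ⟨linearIndependent_vertex q, setOf_finslerNorm_le_one q⟩,
    fun x₀ y₀ z₀ w₀ x₁ y₁ z₁ w₁ hz hT => ?_⟩
  obtain ⟨T, x, y, u, p, q, h⟩ := exists_isExtremal x₀ y₀
  obtain ⟨T', x', y', u', p', q', h'⟩ := exists_isExtremal x₁ (-y₁)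
  rw [h.TF_eq, h'.TF_eq] at *
  have hS0 : 0 ≤ w₁ - w₀ := by linarith [h.nonneg, h'.nonneg]
  have hconcat := h.isFiniteOptimal_concat h' hT
  refine ⟨⟨_, _, _, hconcat⟩, fun xF yF uF H => ?_⟩
  have hcurve := h.isCurve_lift h' hT hz H
  have hlen := H.1.1.finslerLength_lift (z₀ := z₀) (w₀ := w₀) hS0
  have hshort : IsShortestPath ![x₀, y₀, z₀, w₀] ![x₁, y₁, z₁, w₁] 0 (w₁ - w₀)
      (lift z₀ w₀ xF yF) :=
    ⟨hcurve, fun a b γ hγ => hlen.trans_le hγ.le_finslerLength⟩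
  obtain ⟨hxF, hyF⟩ := h.eqOn_concat h' hT H.1 (h.integral_sq_le_of_isFiniteOptimal h' hT H)
  have huF : ∀ᵐ t, t ∈ Icc 0 (w₁ - w₀) → uF t = u t + u' (w₁ - w₀ - t) :=
    H.1.1.ae_eq_u hconcat.1.1 hS0 hyF
  refine ⟨hshort, hlen, ?_, fun a b γ hγ => ?_, fun τ γ hγ hnorm => ?_,
    fun hne => h.chattersBefore h' hT hne huF, fun hne => h.chattersAfter h' hT hne huF,
    fun t ht => ?_, ?_⟩
  · rw [ae_restrict_iff' measurableSet_Icc]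
    filter_upwards [H.1.1.ae_hasDerivAt_lift hS0, H.1.1.ae_finslerNorm_lift hS0] with t h1 h2 ht
    exact ⟨h1 ht, h2 ht⟩
  · obtain ⟨h1, h2, h3⟩ := h.isCurve_eq_lift h' hT hz H hγ.1 ((hγ.2 _ _ _ hcurve).trans_eq hlen)
    refine ⟨_, h1, h2, ?_, ?_, h3⟩
    · simp [hγ.1.2.2.1]
    · simp [hγ.1.2.2.2]
  · have hle : finslerLength 0 τ γ ≤ τ := by
      calc finslerLength 0 τ γ ≤ ∫ t in (0 : ℝ)..τ, (1 : ℝ) :=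
            intervalIntegral.integral_mono_ae_restrict hγ.1 (intervalIntegrable_finslerNorm hγ.2.1)
              intervalIntegrable_const hnorm
        _ = τ := by simp
    refine ⟨hγ.le_finslerLength.trans hle, ?_⟩
    rintro rfl t ht
    obtain ⟨h1, h2, h3⟩ := h.isCurve_eq_lift h' hT hz H hγ hle
    -- The coordinate `w` grows at rate at most one and gains `w₁ - w₀` in time `w₁ - w₀`. The
    -- bounds on `[0, t]` and on `[t, w₁ - w₀]` are therefore equalities, and the reparametrization
    -- is the identity.
    have hw : ∀ s ∈ Icc 0 (w₁ - w₀), ∀ t ∈ Icc 0 (w₁ - w₀), s ≤ t → γ t 3 - γ s 3 ≤ t - s := by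
      intro s hs t ht hst
      have hac := (absolutelyContinuousOnInterval_apply hγ.2.1 3).mono (c := s) (d := t) (by
        rw [uIcc_of_le hst, uIcc_of_le hS0]; exact Icc_subset_Icc hs.1 ht.2)
      rw [← hac.integral_deriv_eq_sub]
      calc ∫ r in s..t, deriv (fun r => γ r 3) r ≤ ∫ r in s..t, (1 : ℝ) := by
            refine intervalIntegral.integral_mono_ae_restrict hst hac.intervalIntegrable_deriv
              intervalIntegrable_const ((ae_restrict_iff' measurableSet_Icc).2 ?_)
            filter_upwards [hγ.ae_deriv_le, (ae_restrict_iff' measurableSet_Icc).1 hnorm]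
              with r h1 h2 hr
            have hr' : r ∈ Icc 0 (w₁ - w₀) := ⟨hs.1.trans hr.1, hr.2.trans ht.2⟩
            exact (h1 hr').trans (h2 hr')
        _ = t - s := by simp
    have hl := hw 0 ⟨le_rfl, hS0⟩ t ht ht.1
    have hr := hw t ht _ ⟨hS0, le_rfl⟩ ht.2
    rw [hγ.2.2.1] at hl
    rw [hγ.2.2.2] at hr
    simp only [Matrix.cons_val] at hl hr
    rw [h3 t ht, show γ t 3 - w₀ = t by linarith]
  · have htm : t ∈ Icc 0 (w₁ - w₀) := ⟨h.nonneg.trans ht.1, by linarith [ht.2, h'.nonneg]⟩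
    have r := h.rest t ht.1
    have r' := h'.rest (w₁ - w₀ - t) (by linarith [ht.2])
    exact ⟨by rw [hxF htm]; simp [r.1, r'.1], by rw [hyF htm]; simp [r.2.1, r'.2.1]⟩
  · rw [ae_restrict_iff' measurableSet_Icc]
    filter_upwards [huF] with t h1 ht
    have htm : t ∈ Icc 0 (w₁ - w₀) := ⟨h.nonneg.trans ht.1, by linarith [ht.2, h'.nonneg]⟩
    rw [h1 htm, (h.rest t ht.1).2.2.1, (h'.rest (w₁ - w₀ - t) (by linarith [ht.2])).2.2.1, add_zero]
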